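/- Let $\mathfrak{sl}_2$ be the Lie algebra of trace zero complex $2\times 2$ matrices with standard basis $x,h,y$, and let $\mathfrak{sl}_2[t]=\mathfrak{sl}_2\otimes\mathbb C[t]$ with bracket $[a\otimes t^r,b\otimes t^s]=[a,b]\otimes t^{r+s}$. A $\mathbb Z$-graded representation of $\mathfrak{sl}_2[t]$ is an $\mathfrak{sl}_2[t]$-module $V=\bigoplus_{p\in\mathbb Z}V[p]$ with $(a\otimes t^r)V[s]\subset V[r+s]$ for all $a\in\mathfrak{sl}_2$, $r\ge 0$, $s\in\mathbb Z$. Let $\mathcal I_{\mathrm{bdd}}$ be the category of $\mathbb Z$-graded representations $V$ such that $V[p]=0$ for all sufficiently negative $p$, $\dim V[p]<\infty$ for all $p$, and the eigenspace $V_\mu=\{v\in V:(h\otimes 1)v=\mu v\}$ is zero for all but finitely many $\mu\in\mathbb Z$; the morphisms are the degree zero maps of $\mathfrak{sl}_2[t]$-modules. For an integer $\lambda\ge 0$ let $W(\lambda)$ be the global Weyl module, i.e. the $\mathfrak{sl}_2[t]$-module generated by an element $w_\lambda$ with defining relations $$(x\otimes \mathbb C[t])w_\lambda=0,\qquad (h\otimes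 1)w_\lambda=\lambda w_\lambda,\qquad (y\otimes 1)^{\lambda+1}w_\lambda=0,$$ and for $r\in\mathbb Z$ let $W(\lambda,r)$ be the module $W(\lambda)$ graded so that $w_\lambda$ has degree $r$. An object $M$ of $\mathcal I_{\mathrm{bdd}}$ has a filtration by global Weyl modules if there are $k\ge 0$ and graded submodules $$M=M^0\supset M^1\supset\cdots\supset M^k\supset M^{k+1}=\{0\}$$ such that for every $0\le s\le k$ there exist $\lambda_s\in\mathbb Z_{\ge 0}$ and $m_{s,p}\in\mathbb Z_{\ge 0}$ $(p\in\mathbb Z)$ and an isomorphism of graded $\mathfrak{sl}_2[t]$-modules $M^s/M^{s+1}\cong\bigoplus_{p\in\mathbb Z}W(\lambda_s,p)^{\oplus m_{s,p}}$ (the inclusions need not be strict, and infinitely many $m_{s,p}$ may be nonzero). Then the full subcategory of $\mathcal I_{\mathrm{bdd}}$ of objects admitting a filtration by global Weyl modules is closed under direct summands, extensions and infinite direct sums. That is: 1. if $M\cong N\oplus N'$ in $\mathcal I_{\mathrm{bdd}}$ and $M$ has a filtration by global Weyl modules, then so does $N$; 2. if $0\to A\to B\to C\to 0$ is a short exact sequence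 in $\mathcal I_{\mathrm{bdd}}$ and $A$ and $C$ have filtrations by global Weyl modules, then so does $B$; 3. if $(N_i)_{i\in I}$ is any family of objects of $\mathcal I_{\mathrm{bdd}}$, each having a filtration by global Weyl modules, whose direct sum $\bigoplus_{i\in I}N_i$ is an object of $\mathcal I_{\mathrm{bdd}}$, then $\bigoplus_{i\in I}N_i$ has a filtration by global Weyl modules. -/

import Mathlib

open CategoryTheory
open scoped TensorProduct

universe u v

attribute [local instance 100] LieRing.ofAssociativeRing

noncomputable section

namespace CurrentSl2

/-! ### The current algebra of `sl₂` -/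

/-- The Lie algebra of complex `2 × 2` matrices of trace zero. -/
abbrev Sl2 : Type := LieAlgebra.SpecialLinear.sl (Fin 2) ℂ

/-- The current algebra `sl₂[t] = ℂ[t] ⊗ sl₂`, with bracket
`[tʳ ⊗ a, tˢ ⊗ b] = tʳ⁺ˢ ⊗ [a, b]`, as a complex Lie algebra. -/
abbrev Cur : Type := Polynomial ℂ ⊗[ℂ] Sl2

/-- The element `a ⊗ tʳ` of the current algebra. -/
def cur (a : Sl2) (r : ℕ) : Cur := (Polynomial.X ^ r : Polynomial ℂ) ⊗ₜ[ℂ] a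

/-- The standard basis element `x = E₁₂`. -/
def slX : Sl2 := LieAlgebra.SpecialLinear.single 0 1 (by decide) 1

/-- The standard basis element `y = E₂₁`. -/
def slY : Sl2 := LieAlgebra.SpecialLinear.single 1 0 (by decide) 1

/-- The standard basis element `h = E₁₁ - E₂₂`. -/
def slH : Sl2 := LieAlgebra.SpecialLinear.singleSubSingle 0 1 1

/-! ### Modules with graded pieces and degree zero maps -/

/-- An `sl₂[t]`-module together with a family of subspaces `V[p]`, `p ∈ ℤ`, the candidates for its
graded pieces. That these pieces form a grading is the predicate `GrMod.IsGraded`. -/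
structure GrMod where
  carrier : Type*
  [addCommGroup : AddCommGroup carrier]
  [module : Module ℂ carrier]
  [lieRingModule : LieRingModule Cur carrier]
  [lieModule : LieModule ℂ Cur carrier]
  deg : ℤ → Submodule ℂ carrier

namespace GrMod

instance : CoeSort GrMod (Type _) := ⟨GrMod.carrier⟩

attribute [instance] addCommGroup module lieRingModule lieModule

/-- Degree zero maps of `sl₂[t]`-modules. -/
structure Hom (M N : GrMod) where
  toLieHom : M.carrier →ₗ⁅ℂ, Cur⁆ N.carrier
  map_deg : ∀ (p : ℤ) (v : M.carrier), v ∈ M.deg p → toLieHom v ∈ N.deg p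

instance : Category GrMod where
  Hom M N := Hom M N
  id M := ⟨LieModuleHom.id, fun _ _ hv => hv⟩
  comp f g := ⟨g.toLieHom.comp f.toLieHom,
    fun p v hv => g.map_deg p _ (f.map_deg p v hv)⟩

/-- The map underlying a morphism. -/
def Hom.fn {M N : GrMod} (f : M ⟶ N) : M → N := fun v => Hom.toLieHom f v

/-- `V` is a `ℤ`-graded representation of `sl₂[t]`: it is the direct sum of the `V[p]`, and
`(a ⊗ tʳ) V[s] ⊆ V[r + s]`. -/
structure IsGraded (V : GrMod) : Prop where
  isInternal : DirectSum.IsInternal V.deg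
  lie_mem : ∀ (a : Sl2) (r : ℕ) (s : ℤ) (v : V), v ∈ V.deg s → ⁅cur a r, v⁆ ∈ V.deg (r + s)

/-- The eigenspace `V_μ = {v : h v = μ v}`, where `h` is identified with `h ⊗ 1`. -/
def wt (V : GrMod) (μ : ℤ) : Submodule ℂ V where
  carrier := {v | ⁅cur slH 0, v⁆ = (μ : ℂ) • v}
  add_mem' {a b} ha hb := by
    simp only [Set.mem_ofPred_eq] at *
    rw [lie_add, ha, hb, smul_add]
  zero_mem' := by simp
  smul_mem' c v hv := by
    simp only [Set.mem_ofPred_eq] at *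
    rw [lie_smul, hv, smul_comm]

/-- The objects of the category `I_bdd`. -/
structure IsBdd (V : GrMod) : Prop extends IsGraded V where
  deg_eq_bot : ∃ p₀ : ℤ, ∀ p < p₀, V.deg p = ⊥
  finiteDimensional : ∀ p : ℤ, FiniteDimensional ℂ (V.deg p)
  finite_wt : {μ : ℤ | V.wt μ ≠ ⊥}.Finite

/-- The direct sum of a family, with `(⨁ Nᵢ)[p] = ⨁ Nᵢ[p]`. -/
def directSum {ι : Type*} (N : ι → GrMod) : GrMod where
  carrier := DirectSum ι fun i => (N i).carrier
  deg p :=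
    { carrier := {v | ∀ i, v i ∈ (N i).deg p}
      add_mem' := fun ha hb i => by
        rw [DirectSum.add_apply]; exact add_mem (ha i) (hb i)
      zero_mem' := fun i => by
        rw [DirectSum.zero_apply]; exact zero_mem _
      smul_mem' := fun c v hv i => by
        rw [DirectSum.smul_apply]; exact Submodule.smul_mem _ c (hv i) }

/-- A submodule is graded if it is spanned by its homogeneous elements. -/
def IsGradedSubmodule (M : GrMod) (A : LieSubmodule ℂ Cur M) : Prop :=
  A.toSubmodule ≤ ⨆ p : ℤ, A.toSubmodule ⊓ M.deg p

/-- The quotient `A / B` of submodules `B ⊆ A` of `M` (in general `A / (A ∩ B)`), whose `p`-th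
graded piece is the image of `A ∩ M[p]`. -/
def subquotient (M : GrMod) (A B : LieSubmodule ℂ Cur M) : GrMod where
  carrier := A ⧸ B.comap A.incl
  deg p := ((M.deg p).comap A.toSubmodule.subtype).map
    (LieSubmodule.Quotient.mk' (B.comap A.incl) : A →ₗ[ℂ] A ⧸ B.comap A.incl)

end GrMod

/-! ### Global Weyl modules -/

/-- The enveloping algebra of the current algebra. -/
abbrev U : Type := UniversalEnvelopingAlgebra ℂ Cur

/-- The canonical map from the current algebra to its enveloping algebra. -/
abbrev inU : Cur →ₗ⁅ℂ⁆ U := UniversalEnvelopingAlgebra.ι ℂ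

/-- The graded piece `U[k]`, spanned by the monomials `(a₁ ⊗ t^r₁) ⋯ (aₛ ⊗ t^rₛ)` with `s ≥ 0` and
`r₁ + ⋯ + rₛ = k`. -/
def degU (k : ℤ) : Submodule ℂ U :=
  Submodule.span ℂ {u | ∃ l : List (Sl2 × ℕ), ((l.map Prod.snd).sum : ℤ) = k ∧
    u = (l.map fun q => inU (cur q.1 q.2)).prod}

/-- The left ideal generated by `x ⊗ tʳ` (`r ≥ 0`), `h ⊗ 1 - n` and `(y ⊗ 1)ⁿ⁺¹`. -/
def weylIdeal (n : ℕ) : Submodule U U :=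
  Submodule.span U (Set.range (fun r : ℕ => inU (cur slX r)) ∪
    {inU (cur slH 0) - algebraMap ℂ U n, inU (cur slY 0) ^ (n + 1)})

/-- The vector space underlying the global Weyl module `W(n)`: the module generated by `wₙ` (the
class of `1`) with relations `(x ⊗ ℂ[t]) wₙ = 0`, `(h ⊗ 1) wₙ = n wₙ`, `(y ⊗ 1)ⁿ⁺¹ wₙ = 0`. -/
abbrev WeylCarrier (n : ℕ) : Type := U ⧸ weylIdeal n

instance (n : ℕ) : LieRingModule Cur (WeylCarrier n) where
  bracket a v := inU a • v
  add_lie a b v := by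
    change inU (a + b) • v = inU a • v + inU b • v
    rw [map_add, add_smul]
  lie_add a v w := smul_add _ v w
  leibniz_lie a b v := by
    change inU a • inU b • v = inU ⁅a, b⁆ • v + inU b • inU a • v
    rw [LieHom.map_lie, LieRing.of_associative_ring_bracket, sub_smul, mul_smul, mul_smul,
      sub_add_cancel]

instance (n : ℕ) : LieModule ℂ Cur (WeylCarrier n) where
  smul_lie c a v := by
    change inU (c • a) • v = c • inU a • v
    rw [map_smul, smul_assoc]
  lie_smul c a v := by
    change inU a • c • v = c • inU a • v
    rw [smul_comm]

/-- The global Weyl module `W(n, r)`: the module `W(n)` graded by placing the generator `wₙ` in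
degree `r`, so that `W(n, r)[p]` is the image of `U[p - r]`. -/
def weyl (n : ℕ) (r : ℤ) : GrMod where
  carrier := WeylCarrier n
  deg p := (degU (p - r)).map ((weylIdeal n).mkQ.restrictScalars ℂ)

/-! ### The category `I_bdd` and global Weyl filtrations -/

/-- The category `I_bdd`, with degree zero maps of `sl₂[t]`-modules as morphisms. -/
abbrev IBdd := ObjectProperty.FullSubcategory GrMod.IsBdd

/-- `M` has a filtration by global Weyl modules: there are graded submodules
`M = M⁰ ⊇ M¹ ⊇ ⋯ ⊇ Mᵏ ⊇ Mᵏ⁺¹ = 0` such that for `0 ≤ s ≤ k` there are `n ≥ 0` and multiplicities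
`m_p ≥ 0` with `Mˢ / Mˢ⁺¹ ≅ ⨁_{p ∈ ℤ} W(n, p)^{⊕ m_p}` by an isomorphism of degree zero. The summands
on the right are indexed by the pairs `(p, j)` with `0 ≤ j < m_p`. -/
def HasWeylFiltration (M : GrMod) : Prop :=
  ∃ (k : ℕ) (F : ℕ → LieSubmodule ℂ Cur M),
    F 0 = ⊤ ∧ F (k + 1) = ⊥ ∧ (∀ s ≤ k, F (s + 1) ≤ F s) ∧
    (∀ s ≤ k + 1, M.IsGradedSubmodule (F s)) ∧
    ∀ s ≤ k, ∃ (n : ℕ) (m : ℤ → ℕ),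
      ∃ e : M.subquotient (F s) (F (s + 1)) ≃ₗ⁅ℂ, Cur⁆
        (GrMod.directSum fun q : (p : ℤ) × Fin (m p) => weyl n q.1),
      ∀ p v, v ∈ (M.subquotient (F s) (F (s + 1))).deg p ↔
        e v ∈ (GrMod.directSum fun q : (p : ℤ) × Fin (m p) => weyl n q.1).deg p

/-- The full subcategory of `I_bdd` of the objects with a filtration by global Weyl modules. -/
def weylFiltered : ObjectProperty IBdd := fun M => HasWeylFiltration M.obj

/-- `N` is a direct summand of `M` in `I_bdd`: `M ≅ N ⊕ N'` for some object `N'`. -/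
def IsDirectSummand (N M : IBdd) : Prop :=
  ∃ N' : IBdd, Nonempty (M.obj ≅ GrMod.directSum ![N.obj, N'.obj])

/-- The sequence `0 → A → B → C → 0` in `I_bdd` is exact. -/
structure IsShortExact {A B C : IBdd} (f : A ⟶ B) (g : B ⟶ C) : Prop where
  injective : Function.Injective (GrMod.Hom.fn f.hom)
  exact : Function.Exact (GrMod.Hom.fn f.hom) (GrMod.Hom.fn g.hom)
  surjective : Function.Surjective (GrMod.Hom.fn g.hom)

end CurrentSl2

end

open CurrentSl2

noncomputable section

namespace CurrentSl2

/-! ### Families of independent subspaces -/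

section LinearAlgebra

variable {K V W ι : Type*} [Field K] [AddCommGroup V] [Module K V] [AddCommGroup W] [Module K W]

/-! The module `W(n, p)` behaves like a projective object among modules whose weights are at most
`n` and on which `y ⊗ 1` is locally nilpotent. A bihomogeneous vector of degree `p` and weight `n`
is killed by every `x ⊗ tˢ`, since these raise the weight, and local nilpotency then forces the
relation for `(y ⊗ 1)ⁿ⁺¹`; so it is the image of the generator (`IsHighest.exists_hom`).

Hence there is a canonical candidate for a filtration: take the submodule `M.top n` generated by the
highest weight space, pass to the quotient, and continue with `n - 1`. `Layered` says that every
layer is a direct sum of global Weyl modules. For objects of `I_bdd` this is equivalent to having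
some filtration by global Weyl modules (`layered_of_hasWeylFiltration`,
`hasWeylFiltration_of_layered`). Since `top` is functorial, the closure properties can be checked
one layer at a time. Retracts of direct sums are treated by `layered_of_isRetract`, which covers
both summands and infinite sums. Extensions are treated by `layered_of_exact`: the highest layers
split by projectivity and the quotients again form an exact sequence.

The core is `isFree_of_isRetract`, a graded Nakayama argument: degrees are bounded below, `W(n, p)`
starts in degree `p`, and its part of degree `p` and weight `n` is the line through the generator.
Choosing bihomogeneous vectors requires `h ⊗ 1` to be diagonalizable with integral eigenvalues,
which is `integralPart_eq_top` applied to each finite-dimensional piece `V[p]`. -/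

/-- Comparing components in the independent family `B`, only the `i`-th component of `v` contributes
to `f v`. All later lifts of homogeneous or weight vectors come from this. -/
lemma exists_mem_map_eq_of_iSupIndep (f : V →ₗ[K] W) {A : ι → Submodule K V}
    {B : ι → Submodule K W} (hB : iSupIndep B) (hf : ∀ i, ∀ a ∈ A i, f a ∈ B i) {v : V}
    (hv : v ∈ ⨆ i, A i) {i : ι} (hi : f v ∈ B i) : ∃ a ∈ A i, f a = f v := by
  classical
  obtain ⟨g, hg, rfl⟩ := (Submodule.mem_iSup_iff_exists_finsupp ..).mp hv
  refine ⟨g i, hg i, ?_⟩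
  set v := g.sum fun _ x => x with hvdef
  have hsum : f v = ∑ j ∈ insert i g.support, f (g j) := by
    rw [hvdef, Finsupp.sum, map_sum]
    refine Finset.sum_subset (Finset.subset_insert _ _) fun j _ hj => ?_
    rw [Finsupp.notMem_support_iff.mp hj, map_zero]
  have := (iSupIndep_iff_finsetSum_eq_zero_imp_eq_zero B).mp hB (insert i g.support)
    (fun j => f (g j) - if j = i then f v else 0) (fun j _ => ?_) ?_ i (Finset.mem_insert_self _ _)
  · simpa [sub_eq_zero] using this
  · refine sub_mem (hf j _ (hg j)) ?_
    split_ifs with h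
    · exact h ▸ hi
    · exact zero_mem _
  · rw [Finset.sum_sub_distrib, ← hsum]
    simp

/-- The components of `f v` vanish separately, so the kernel of a graded map is graded. -/
lemma mem_iSup_inf_ker_of_iSupIndep (f : V →ₗ[K] W) {A : ι → Submodule K V}
    {B : ι → Submodule K W} (hB : iSupIndep B) (hf : ∀ i, ∀ a ∈ A i, f a ∈ B i) {v : V}
    (hv : v ∈ ⨆ i, A i) (h0 : f v = 0) : v ∈ ⨆ i, A i ⊓ LinearMap.ker f := by
  classical
  obtain ⟨g, hg, rfl⟩ := (Submodule.mem_iSup_iff_exists_finsupp ..).mp hv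
  refine (Submodule.mem_iSup_iff_exists_finsupp ..).mpr ⟨g, fun i => ⟨hg i, ?_⟩, rfl⟩
  by_cases hi : i ∈ g.support
  · refine (iSupIndep_iff_finsetSum_eq_zero_imp_eq_zero B).mp hB g.support
      (fun j => f (g j)) (fun j _ => hf j _ (hg j)) ?_ i hi
    rwa [Finsupp.sum, map_sum] at h0
  · simp [Finsupp.notMem_support_iff.mp hi]

/-- A relation in the quotient lifts to a sum lying in `S`; as `S` is graded, each component of that
sum lies in `S`. -/
lemma iSupIndep_map_mkQ {A : ι → Submodule K V} (hA : iSupIndep A) {S : Submodule K V}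
    (hS : S ≤ ⨆ i, S ⊓ A i) : iSupIndep fun i => (A i).map S.mkQ := by
  classical
  rw [iSupIndep_iff_finsetSum_eq_zero_imp_eq_zero]
  intro s w hw h0 i hi
  choose! a ha haw using hw
  have hmem : ∑ j ∈ s, a j ∈ S := by
    rw [← Submodule.Quotient.mk_eq_zero, ← Submodule.mkQ_apply, map_sum, ← h0]
    exact Finset.sum_congr rfl haw
  obtain ⟨g, hg, hgs⟩ := (Submodule.mem_iSup_iff_exists_finsupp ..).mp (hS hmem)
  have key := (iSupIndep_iff_finsetSum_eq_zero_imp_eq_zero A).mp hA (s ∪ g.support)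
    (fun j => (if j ∈ s then a j else 0) - g j) (fun j _ => ?_) ?_ i (Finset.mem_union_left _ hi)
  · rw [← haw i hi, Submodule.mkQ_apply, Submodule.Quotient.mk_eq_zero]
    rw [if_pos hi, sub_eq_zero] at key
    exact key ▸ (hg i).1
  · refine sub_mem ?_ (hg j).2
    split_ifs with h
    · exact ha j h
    · exact zero_mem _
  · rw [Finset.sum_sub_distrib, sub_eq_zero, ← Finset.sum_filter]
    rw [Finset.filter_mem_eq_inter, Finset.inter_eq_right.mpr Finset.subset_union_left, ← hgs,
      Finsupp.sum]
    refine Finset.sum_subset Finset.subset_union_right fun j _ hj => ?_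
    exact Finsupp.notMem_support_iff.mp hj

end LinearAlgebra

/-! ### Brackets in the current algebra -/

lemma val_slX : (slX : Matrix (Fin 2) (Fin 2) ℂ) = !![0, 1; 0, 0] := by
  ext i j; fin_cases i <;> fin_cases j <;> simp [slX]

lemma val_slY : (slY : Matrix (Fin 2) (Fin 2) ℂ) = !![0, 0; 1, 0] := by
  ext i j; fin_cases i <;> fin_cases j <;> simp [slY]

lemma val_slH : (slH : Matrix (Fin 2) (Fin 2) ℂ) = !![1, 0; 0, -1] := by
  ext i j
  fin_cases i <;> fin_cases j <;>
    simp [slH, LieAlgebra.SpecialLinear.val_singleSubSingle]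

lemma lie_slX_slY : ⁅slX, slY⁆ = slH := by
  apply Subtype.ext
  rw [LieSubalgebra.coe_bracket, val_slX, val_slY, val_slH, LieRing.of_associative_ring_bracket]
  ext i j; fin_cases i <;> fin_cases j <;> simp

lemma lie_slH_slX : ⁅slH, slX⁆ = (2 : ℂ) • slX := by
  apply Subtype.ext
  change _ = (2 : ℂ) • (slX : Matrix (Fin 2) (Fin 2) ℂ)
  rw [LieAlgebra.SpecialLinear.sl_bracket, val_slX, val_slH]
  ext i j; fin_cases i <;> fin_cases j <;> norm_num [Matrix.mul_apply, Fin.sum_univ_two]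

lemma lie_slH_slY : ⁅slH, slY⁆ = (-2 : ℂ) • slY := by
  apply Subtype.ext
  change _ = (-2 : ℂ) • (slY : Matrix (Fin 2) (Fin 2) ℂ)
  rw [LieAlgebra.SpecialLinear.sl_bracket, val_slY, val_slH]
  ext i j; fin_cases i <;> fin_cases j <;> norm_num [Matrix.mul_apply, Fin.sum_univ_two]

lemma sl2_eq (a : Sl2) : a = (a.1 0 1) • slX + (a.1 0 0) • slH + (a.1 1 0) • slY := by
  have htr : a.1 0 0 + a.1 1 1 = 0 := by
    have := LinearMap.mem_ker.mp (show a.1 ∈ LinearMap.ker (Matrix.traceLinearMap _ _ _) from a.2)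
    rwa [Matrix.traceLinearMap_apply, Matrix.trace_fin_two] at this
  apply Subtype.ext
  change _ = (a.1 0 1) • (slX : Matrix (Fin 2) (Fin 2) ℂ) +
    (a.1 0 0) • (slH : Matrix (Fin 2) (Fin 2) ℂ) + (a.1 1 0) • (slY : Matrix (Fin 2) (Fin 2) ℂ)
  rw [val_slX, val_slY, val_slH]
  ext i j
  fin_cases i <;> fin_cases j <;> simp
  linear_combination htr

lemma isSl2Triple : IsSl2Triple slH slX slY where
  h_ne_zero h := by
    have := congrFun (congrFun (congrArg Subtype.val h) 0) 0
    rw [val_slH] at this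
    simp at this
  lie_e_f := lie_slX_slY
  lie_h_e_nsmul := by rw [lie_slH_slX, ← Nat.cast_smul_eq_nsmul ℂ]; norm_num
  lie_h_f_nsmul := by rw [lie_slH_slY, ← Nat.cast_smul_eq_nsmul ℂ, neg_smul]; norm_num

lemma lie_cur (a b : Sl2) (r s : ℕ) : ⁅cur a r, cur b s⁆ = cur ⁅a, b⁆ (r + s) := by
  rw [cur, cur, cur, LieAlgebra.ExtendScalars.bracket_tmul, pow_add]

/-- The map `a ↦ a ⊗ tʳ`. -/
def curLin (r : ℕ) : Sl2 →ₗ[ℂ] Cur := TensorProduct.mk ℂ (Polynomial ℂ) Sl2 (Polynomial.X ^ r)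

lemma curLin_apply (r : ℕ) (a : Sl2) : curLin r a = cur a r := rfl

lemma cur_add (a b : Sl2) (r : ℕ) : cur (a + b) r = cur a r + cur b r := map_add (curLin r) a b

lemma cur_smul (c : ℂ) (a : Sl2) (r : ℕ) : cur (c • a) r = c • cur a r := map_smul (curLin r) c a

lemma mem_of_cur_mem {S : Submodule ℂ Cur} (h : ∀ a r, cur a r ∈ S) (c : Cur) : c ∈ S := by
  induction c using TensorProduct.induction_on with
  | zero => exact zero_mem _
  | add a b ha hb => exact add_mem ha hb
  | tmul p a =>
    induction p using Polynomial.induction_on' with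
    | add p q hp hq => rw [TensorProduct.add_tmul]; exact add_mem hp hq
    | monomial r c =>
      rw [← mul_one c, ← smul_eq_mul, ← Polynomial.smul_monomial, ← Polynomial.X_pow_eq_monomial,
        ← TensorProduct.smul_tmul']
      exact S.smul_mem c (h a r)

section Module

variable {V : Type*} [AddCommGroup V] [Module ℂ V] [LieRingModule Cur V] [LieModule ℂ Cur V]

lemma lie_mem_of_cur {S : Submodule ℂ V} {v : V} (h : ∀ a r, ⁅cur a r, v⁆ ∈ S) (c : Cur) :
    ⁅c, v⁆ ∈ S :=
  mem_of_cur_mem (S := S.comap ((LieModule.toEnd ℂ Cur V : Cur →ₗ[ℂ] Module.End ℂ V).flip v)) h c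

lemma cur_smul_lie (c : ℂ) (a : Sl2) (r : ℕ) (v : V) :
    ⁅cur (c • a) r, v⁆ = c • ⁅cur a r, v⁆ := by
  rw [cur_smul]
  exact smul_lie _ _ _

lemma cur_lie_mem {S : Submodule ℂ V} {v : V} {r : ℕ} (hx : ⁅cur slX r, v⁆ ∈ S)
    (hh : ⁅cur slH r, v⁆ ∈ S) (hy : ⁅cur slY r, v⁆ ∈ S) (a : Sl2) : ⁅cur a r, v⁆ ∈ S := by
  rw [sl2_eq a, cur_add, cur_add, add_lie, add_lie, cur_smul_lie, cur_smul_lie, cur_smul_lie]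
  exact add_mem (add_mem (S.smul_mem _ hx) (S.smul_mem _ hh)) (S.smul_mem _ hy)

omit [Module ℂ V] [LieModule ℂ Cur V] in
lemma curX_curY (r s : ℕ) (v : V) : ⁅cur slX r, ⁅cur slY s, v⁆⁆ =
    ⁅cur slY s, ⁅cur slX r, v⁆⁆ + ⁅cur slH (r + s), v⁆ := by
  rw [leibniz_lie, lie_cur, lie_slX_slY, add_comm]

lemma curH_curX (r s : ℕ) (v : V) : ⁅cur slH r, ⁅cur slX s, v⁆⁆ =
    ⁅cur slX s, ⁅cur slH r, v⁆⁆ + (2 : ℂ) • ⁅cur slX (r + s), v⁆ := by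
  rw [leibniz_lie, lie_cur, lie_slH_slX, cur_smul_lie, add_comm]

lemma curH_curY (r s : ℕ) (v : V) : ⁅cur slH r, ⁅cur slY s, v⁆⁆ =
    ⁅cur slY s, ⁅cur slH r, v⁆⁆ - (2 : ℂ) • ⁅cur slY (r + s), v⁆ := by
  rw [leibniz_lie, lie_cur, lie_slH_slY, cur_smul_lie, add_comm, neg_smul, sub_eq_add_neg]

omit [Module ℂ V] [LieModule ℂ Cur V] in
lemma curH_curH (r s : ℕ) (v : V) : ⁅cur slH r, ⁅cur slH s, v⁆⁆ =
    ⁅cur slH s, ⁅cur slH r, v⁆⁆ := by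
  rw [leibniz_lie, lie_cur, lie_self, ← curLin_apply, map_zero, zero_lie, zero_add]

end Module

end CurrentSl2

end

noncomputable section

namespace CurrentSl2

/-! ### Finite-dimensional representations of `sl₂` -/

section Sl2Module

open Module LieModule

variable {V : Type*} [AddCommGroup V] [Module ℂ V] [LieRingModule Sl2 V] [LieModule ℂ Sl2 V]

omit [Module ℂ V] [LieModule ℂ Sl2 V] in
lemma sl2_XY (v : V) : ⁅slX, ⁅slY, v⁆⁆ = ⁅slY, ⁅slX, v⁆⁆ + ⁅slH, v⁆ := by
  rw [leibniz_lie, lie_slX_slY, add_comm]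

lemma sl2_HX (v : V) : ⁅slH, ⁅slX, v⁆⁆ = ⁅slX, ⁅slH, v⁆⁆ + (2 : ℂ) • ⁅slX, v⁆ := by
  rw [leibniz_lie, lie_slH_slX, smul_lie, add_comm]

lemma sl2_HY (v : V) : ⁅slH, ⁅slY, v⁆⁆ = ⁅slY, ⁅slH, v⁆⁆ - (2 : ℂ) • ⁅slY, v⁆ := by
  rw [leibniz_lie, lie_slH_slY, smul_lie, add_comm, neg_smul, sub_eq_add_neg]

lemma sl2_H_X_of_eigen {c : ℂ} {v : V} (hv : ⁅slH, v⁆ = c • v) :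
    ⁅slH, ⁅slX, v⁆⁆ = (c + 2) • ⁅slX, v⁆ := by
  rw [sl2_HX, hv, lie_smul, add_smul]

lemma sl2_H_Y_of_eigen {c : ℂ} {v : V} (hv : ⁅slH, v⁆ = c • v) :
    ⁅slH, ⁅slY, v⁆⁆ = (c - 2) • ⁅slY, v⁆ := by
  rw [sl2_HY, hv, lie_smul, sub_smul]

lemma sl2_lie_eq {a : Sl2} {v : V} : ⁅a, v⁆ =
    (a.1 0 1) • ⁅slX, v⁆ + (a.1 0 0) • ⁅slH, v⁆ + (a.1 1 0) • ⁅slY, v⁆ := by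
  conv_lhs => rw [sl2_eq a]
  simp only [add_lie, smul_lie]

variable (V) in
/-- The sum of the eigenspaces of `h` with integral eigenvalue. -/
def integralPart : LieSubmodule ℂ Sl2 V where
  __ := ⨆ n : ℤ, (toEnd ℂ Sl2 V slH).eigenspace (n : ℂ)
  lie_mem {a v} hv := by
    change v ∈ ⨆ n : ℤ, (toEnd ℂ Sl2 V slH).eigenspace (n : ℂ) at hv
    change ⁅a, v⁆ ∈ ⨆ n : ℤ, (toEnd ℂ Sl2 V slH).eigenspace (n : ℂ)
    induction hv using Submodule.iSup_induction' with
    | zero => rw [lie_zero]; exact zero_mem _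
    | add u v _ _ hu hv => rw [lie_add]; exact add_mem hu hv
    | mem n v hv =>
      have hv' : ⁅slH, v⁆ = (n : ℂ) • v := End.mem_eigenspace_iff.mp hv
      rw [sl2_lie_eq]
      refine add_mem (add_mem ?_ ?_) ?_ <;> apply Submodule.smul_mem
      · refine Submodule.mem_iSup_of_mem (n + 2) (End.mem_eigenspace_iff.mpr ?_)
        rw [toEnd_apply_apply, sl2_H_X_of_eigen hv']
        push_cast; rfl
      · rw [hv']
        exact Submodule.smul_mem _ _ (Submodule.mem_iSup_of_mem n hv)
      · refine Submodule.mem_iSup_of_mem (n - 2) (End.mem_eigenspace_iff.mpr ?_)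
        rw [toEnd_apply_apply, sl2_H_Y_of_eigen hv']
        push_cast; rfl

/-- The subspace of `h`-eigenvectors of eigenvalue `c`. -/
abbrev hEig (V : Type*) [AddCommGroup V] [Module ℂ V] [LieRingModule Sl2 V] [LieModule ℂ Sl2 V]
    (c : ℂ) : Submodule ℂ V := (toEnd ℂ Sl2 V slH).eigenspace c

lemma mem_hEig {c : ℂ} {v : V} : v ∈ hEig V c ↔ ⁅slH, v⁆ = c • v := End.mem_eigenspace_iff

/-- Nonzero eigenvectors for distinct eigenvalues are independent, so there cannot be infinitely
many. -/
lemma exists_eq_zero_of_eigen [FiniteDimensional ℂ V] {a : ℕ → ℂ} (ha : Function.Injective a)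
    {f : ℕ → V} (hf : ∀ k, ⁅slH, f k⁆ = a k • f k) : ∃ k, f k = 0 := by
  by_contra! contra
  have h := End.eigenvectors_linearIndependent' (toEnd ℂ Sl2 V slH) a ha f
    fun k => ⟨mem_hEig.mpr (hf k), contra k⟩
  exact not_finite_iff_infinite.mpr (inferInstance : Infinite ℕ) h.finite

lemma exists_pow_X_eq_zero [FiniteDimensional ℂ V] {c : ℂ} {v : V} (hv : ⁅slH, v⁆ = c • v) :
    ∃ k, ((toEnd ℂ Sl2 V slX) ^ k) v = 0 :=
  exists_eq_zero_of_eigen (a := fun k : ℕ => c + 2 * k) (fun a b hab => by simpa using hab)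
    fun k => isSl2Triple.lie_h_pow_toEnd_e hv k

lemma lie_Y_pow_Y (k : ℕ) (v : V) :
    ⁅slY, ((toEnd ℂ Sl2 V slY) ^ k) v⁆ = ((toEnd ℂ Sl2 V slY) ^ (k + 1)) v := by
  rw [pow_succ', Module.End.mul_apply, toEnd_apply_apply]

lemma lie_X_pow_X (k : ℕ) (v : V) :
    ⁅slX, ((toEnd ℂ Sl2 V slX) ^ k) v⁆ = ((toEnd ℂ Sl2 V slX) ^ (k + 1)) v := by
  rw [pow_succ', Module.End.mul_apply, toEnd_apply_apply]

/-- `xᵏ y z = y xᵏ z + k (c + k - 1) xᵏ⁻¹ z` for `z` of weight `c`. -/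
lemma pow_X_lie_Y {c : ℂ} {z : V} (hz : ⁅slH, z⁆ = c • z) (k : ℕ) :
    ((toEnd ℂ Sl2 V slX) ^ (k + 1)) ⁅slY, z⁆ = ⁅slY, ((toEnd ℂ Sl2 V slX) ^ (k + 1)) z⁆ +
      ((k + 1) * (c + k)) • ((toEnd ℂ Sl2 V slX) ^ k) z := by
  induction k with
  | zero => simp [sl2_XY, hz]
  | succ k ih =>
    rw [← lie_X_pow_X, ih, lie_add, sl2_XY, lie_smul, lie_X_pow_X, lie_X_pow_X,
      isSl2Triple.lie_h_pow_toEnd_e hz, add_assoc, ← add_smul]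
    congr 2
    push_cast
    ring

/-- Apply `pow_X_lie_Y` to the last nonzero `xᵏ z`: the coefficient `(k + 1) (m + 2 + k)` does not
vanish. -/
lemma XY_injOn [FiniteDimensional ℂ V] {m : ℕ} {z : V} (hz : ⁅slH, z⁆ = ((m : ℂ) + 2) • z)
    (h : ⁅slX, ⁅slY, z⁆⁆ = 0) : z = 0 := by
  by_contra hne
  obtain ⟨k, hk, hk'⟩ := Nat.exists_not_and_succ_of_not_zero_of_exists
    (p := fun k => ((toEnd ℂ Sl2 V slX) ^ k) z = 0) (by simpa using hne) (exists_pow_X_eq_zero hz)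
  have := pow_X_lie_Y hz k
  rw [hk', lie_zero, zero_add, pow_succ, Module.End.mul_apply, toEnd_apply_apply, h, map_zero,
    eq_comm, smul_eq_zero_iff_left hk] at this
  have h2 : (((k + 1) * (m + 2 + k) : ℕ) : ℂ) = 0 := by push_cast; exact this
  exact absurd h2 (Nat.cast_ne_zero.mpr (by positivity))

/-- An injective endomorphism of a finite-dimensional eigenspace is surjective. -/
lemma XY_surjOn [FiniteDimensional ℂ V] {m : ℕ} {w : V} (hw : ⁅slH, w⁆ = ((m : ℂ) + 2) • w) :
    ∃ z : V, ⁅slH, z⁆ = ((m : ℂ) + 2) • z ∧ ⁅slX, ⁅slY, z⁆⁆ = w := by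
  let f : End ℂ V := toEnd ℂ Sl2 V slX ∘ₗ toEnd ℂ Sl2 V slY
  have hf : ∀ z ∈ hEig V (m + 2), f z ∈ hEig V (m + 2) := fun z hz => by
    rw [mem_hEig] at hz ⊢
    have := sl2_H_X_of_eigen (sl2_H_Y_of_eigen hz)
    rw [sub_add_cancel] at this
    exact this
  have hinj : Function.Injective (f.restrict hf) := by
    rw [injective_iff_map_eq_zero]
    rintro ⟨z, hz⟩ h
    exact Subtype.ext (XY_injOn (mem_hEig.mp hz) (congrArg Subtype.val h))
  obtain ⟨⟨z, hz⟩, hzw⟩ := (LinearMap.injective_iff_surjective.mp hinj) ⟨w, mem_hEig.mpr hw⟩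
  exact ⟨z, mem_hEig.mp hz, congrArg Subtype.val hzw⟩

lemma lie_H_pow_Y {m : ℂ} {v d : V} (hv : ⁅slH, v⁆ = m • v + d) (k : ℕ) :
    ⁅slH, ((toEnd ℂ Sl2 V slY) ^ k) v⁆ =
      (m - 2 * k) • ((toEnd ℂ Sl2 V slY) ^ k) v + ((toEnd ℂ Sl2 V slY) ^ k) d := by
  induction k with
  | zero => simpa using hv
  | succ k ih =>
    rw [← lie_Y_pow_Y, sl2_HY, ih, lie_add, lie_smul, lie_Y_pow_Y, lie_Y_pow_Y]
    push_cast
    module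

/-- `x yᵏ⁺¹ v = (k + 1) ((m - k) yᵏ v + yᵏ d)` if `x v = 0` and `h v = m v + d`. -/
lemma lie_X_pow_Y {m : ℂ} {v d : V} (hx : ⁅slX, v⁆ = 0) (hv : ⁅slH, v⁆ = m • v + d) (k : ℕ) :
    ⁅slX, ((toEnd ℂ Sl2 V slY) ^ (k + 1)) v⁆ = ((k : ℂ) + 1) •
      ((m - k) • ((toEnd ℂ Sl2 V slY) ^ k) v + ((toEnd ℂ Sl2 V slY) ^ k) d) := by
  induction k with
  | zero =>
    simp [sl2_XY, hx, hv]
  | succ k ih =>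
    rw [← lie_Y_pow_Y, sl2_XY, ih, lie_H_pow_Y hv, lie_smul, lie_add, lie_smul, lie_Y_pow_Y,
      lie_Y_pow_Y]
    push_cast
    module

/-- This excludes a Jordan block of `h` at a highest weight. If `d ≠ 0`, then `yᵐ d ≠ 0` and `yᵐ⁺¹ d
= 0`, so `x yᵐ⁺¹ v = (m + 1) yᵐ d ≠ 0`. The vectors `yᵐ⁺¹⁺ᵏ v` are genuine eigenvectors with
distinct eigenvalues, so they eventually vanish, and the first vanishing contradicts `lie_X_pow_Y`.
-/
lemma eq_zero_of_lie_H_eq_add [FiniteDimensional ℂ V] {m : ℕ} {v d : V} (hx : ⁅slX, v⁆ = 0)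
    (hv : ⁅slH, v⁆ = (m : ℂ) • v + d) (hd : ⁅slH, d⁆ = (m : ℂ) • d) (hxd : ⁅slX, d⁆ = 0) :
    d = 0 := by
  by_contra hne
  have P : isSl2Triple.HasPrimitiveVectorWith d (m : ℂ) := ⟨hne, hd, hxd⟩
  have hd0 : ∀ j, ((toEnd ℂ Sl2 V slY) ^ (m + 1 + j)) d = 0 := fun j => by
    rw [add_comm, pow_add, Module.End.mul_apply, P.pow_toEnd_f_eq_zero_of_eq_nat rfl, map_zero]
  have h1 := lie_X_pow_Y hx hv m
  rw [sub_self, zero_smul, zero_add] at h1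
  have h2 : ((toEnd ℂ Sl2 V slY) ^ (m + 1 + 0)) v ≠ 0 := by
    intro h0
    rw [add_zero] at h0
    rw [h0, lie_zero, eq_comm, smul_eq_zero] at h1
    exact h1.elim (Nat.cast_add_one_ne_zero m) (P.pow_toEnd_f_ne_zero_of_eq_nat rfl le_rfl)
  obtain ⟨k, hk, hk'⟩ := Nat.exists_not_and_succ_of_not_zero_of_exists
    (p := fun k => ((toEnd ℂ Sl2 V slY) ^ (m + 1 + k)) v = 0) h2
    (exists_eq_zero_of_eigen (a := fun k : ℕ => (m : ℂ) - 2 * (m + 1 + k : ℕ))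
      (fun a b hab => by simpa using hab)
      fun k => by rw [lie_H_pow_Y hv, hd0, add_zero])
  have h3 := lie_X_pow_Y hx hv (m + 1 + k)
  rw [← add_assoc] at hk'
  rw [hk', lie_zero, hd0, add_zero, eq_comm, smul_eq_zero, smul_eq_zero] at h3
  rcases h3 with h3 | h3 | h3
  · exact Nat.cast_add_one_ne_zero _ h3
  · push_cast at h3
    have : ((k + 1 : ℕ) : ℂ) = 0 := by push_cast; linear_combination -h3
    exact absurd this (Nat.cast_ne_zero.mpr (by positivity))
  · exact hk h3

lemma mem_integralPart {n : ℤ} {v : V} (hv : ⁅slH, v⁆ = (n : ℂ) • v) : v ∈ integralPart V :=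
  (Submodule.mem_iSup_of_mem n (mem_hEig.mpr hv) :
    v ∈ ⨆ n : ℤ, (toEnd ℂ Sl2 V slH).eigenspace (n : ℂ))

lemma iSupIndep_hEig : iSupIndep fun n : ℤ => hEig V (n : ℂ) :=
  (End.eigenspaces_iSupIndep _).comp Int.cast_injective

/-- On `integralPart V` the operator `h` is diagonalizable, so the image of `h - n` there meets the
`n`-eigenspace only in zero. -/
lemma lie_H_eq_of_mem_integralPart {n : ℤ} {u w : V} (hu : u ∈ integralPart V)
    (huw : ⁅slH, u⁆ = (n : ℂ) • u + w) (hw : ⁅slH, w⁆ = (n : ℂ) • w) : w = 0 := by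
  have hu' : (toEnd ℂ Sl2 V slH - (n : ℂ) • (1 : End ℂ V)) u = w := by simp [huw]
  have hf : ∀ i : ℤ, ∀ a ∈ hEig V (i : ℂ),
      (toEnd ℂ Sl2 V slH - (n : ℂ) • (1 : End ℂ V)) a ∈ hEig V (i : ℂ) := fun i a ha => by
    simp only [LinearMap.sub_apply, toEnd_apply_apply, mem_hEig.mp ha, LinearMap.smul_apply,
      Module.End.one_apply]
    exact sub_mem (Submodule.smul_mem _ _ ha) (Submodule.smul_mem _ _ ha)
  obtain ⟨a, ha, h⟩ := exists_mem_map_eq_of_iSupIndep _ iSupIndep_hEig hf (v := u) hu (i := n)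
    (by rw [hu']; exact mem_hEig.mpr hw)
  rw [← hu', ← h]
  simp [mem_hEig.mp ha]

/-- The operator `h - n` is invertible on the eigenspaces of the other eigenvalues. -/
lemma exists_mem_integralPart_sub_mem {n : ℤ} {d : V} (hd : d ∈ integralPart V) :
    ∃ d' ∈ integralPart V, d - (⁅slH, d'⁆ - (n : ℂ) • d') ∈ hEig V n := by
  change d ∈ ⨆ n : ℤ, hEig V (n : ℂ) at hd
  induction hd using Submodule.iSup_induction' with
  | zero => exact ⟨0, zero_mem _, by simp⟩
  | add u v _ _ hu hv =>
    obtain ⟨u', hu', h1⟩ := hu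
    obtain ⟨v', hv', h2⟩ := hv
    refine ⟨u' + v', add_mem hu' hv', ?_⟩
    have := add_mem h1 h2
    rw [lie_add, smul_add]
    convert this using 1
    abel
  | mem k v hv =>
    by_cases hkn : k = n
    · subst hkn
      exact ⟨0, zero_mem _, by simpa using hv⟩
    · have hne : (k : ℂ) - n ≠ 0 := sub_ne_zero.mpr (Int.cast_injective.ne hkn)
      rw [mem_hEig] at hv
      refine ⟨((k : ℂ) - n)⁻¹ • v, Submodule.smul_mem _ _ (mem_integralPart hv), ?_⟩
      rw [lie_smul, hv, smul_comm (n : ℂ), ← smul_sub, ← sub_smul, smul_smul,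
        inv_mul_cancel₀ hne, one_smul, sub_self]
      exact zero_mem _

/-- `h` acts semisimply, with integral eigenvalues, on a finite-dimensional representation. -/
theorem integralPart_eq_top [FiniteDimensional ℂ V] : integralPart V = ⊤ := by
  by_contra hne
  have : Nontrivial (V ⧸ integralPart V) :=
    Submodule.Quotient.nontrivial_iff.mpr fun h => hne ((LieSubmodule.toSubmodule_eq_top _).mp h)
  have : FiniteDimensional ℂ (V ⧸ integralPart V) :=
    inferInstanceAs (FiniteDimensional ℂ (V ⧸ (integralPart V).toSubmodule))
  -- A primitive vector of the nonzero quotient will be lifted to an `h`-eigenvector of `V`, which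
  -- must already lie in `integralPart V`.
  obtain ⟨μ, q, hq0, P⟩ :=
    isSl2Triple.exists_hasPrimitiveVectorWith (R := ℂ) (M := V ⧸ integralPart V)
  obtain ⟨m, rfl⟩ := P.exists_nat
  obtain ⟨v, rfl⟩ := LieSubmodule.Quotient.surjective_mk' _ q
  have hvD : v ∉ integralPart V := fun h => hq0 ((LieSubmodule.Quotient.mk_eq_zero _).mpr h)
  have hXv : ⁅slX, v⁆ ∈ integralPart V := by
    rw [← LieSubmodule.Quotient.mk_eq_zero, LieModuleHom.map_lie]
    exact P.lie_e
  have hHv : ⁅slH, v⁆ - (m : ℂ) • v ∈ integralPart V := by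
    rw [← LieSubmodule.Quotient.mk_eq_zero, map_sub, LieModuleHom.map_lie, map_smul,
      sub_eq_zero]
    exact P.lie_h
  -- Subtracting `d'` from the lift leaves an error `d` that is itself an eigenvector of eigenvalue
  -- `m`.
  obtain ⟨d', hd', hd⟩ := exists_mem_integralPart_sub_mem (n := m) hHv
  rw [Int.cast_natCast] at hd
  set d := ⁅slH, v⁆ - (m : ℂ) • v - (⁅slH, d'⁆ - (m : ℂ) • d') with hddef
  rw [mem_hEig] at hd
  set v₁ := v - d' with hv₁
  have hHv₁ : ⁅slH, v₁⁆ = (m : ℂ) • v₁ + d := by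
    rw [hddef, hv₁, lie_sub, smul_sub]; abel
  have hXv₁ : ⁅slX, v₁⁆ ∈ integralPart V := by
    rw [hv₁, lie_sub]
    exact sub_mem hXv (LieSubmodule.lie_mem _ hd')
  have hHXv₁ : ⁅slH, ⁅slX, v₁⁆⁆ = ((m : ℂ) + 2) • ⁅slX, v₁⁆ + ⁅slX, d⁆ := by
    rw [sl2_HX, hHv₁, lie_add, lie_smul]; module
  have hcast : (((m + 2 : ℤ)) : ℂ) = (m : ℂ) + 2 := by push_cast; rfl
  have hXd : ⁅slX, d⁆ = 0 := by
    refine lie_H_eq_of_mem_integralPart (n := m + 2) hXv₁ ?_ ?_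
    · rw [hcast, hHXv₁]
    · rw [hcast, sl2_H_X_of_eigen hd]
  rw [hXd, add_zero] at hHXv₁
  -- With `x y z = x v₁`, the vector `v₁ - y z` is killed by `x` and has the same error `d`.
  obtain ⟨z, hz, hzv⟩ := XY_surjOn hHXv₁
  have hHYz := sl2_H_Y_of_eigen hz
  rw [add_sub_cancel_right] at hHYz
  have hd0 : d = 0 := by
    refine eq_zero_of_lie_H_eq_add (v := v₁ - ⁅slY, z⁆) (m := m) ?_ ?_ hd hXd
    · rw [lie_sub, hzv, sub_self]
    · rw [lie_sub, hHv₁, hHYz]; module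
  rw [hd0, add_zero] at hHv₁
  refine hvD ?_
  rw [show v = v₁ + d' by rw [hv₁, sub_add_cancel]]
  exact add_mem (mem_integralPart (n := m) (by rw [Int.cast_natCast, hHv₁])) hd'

end Sl2Module

end CurrentSl2

end

noncomputable section

namespace CurrentSl2

/-- Group a relation by the first index and use `hA`; within one group use `hB`. -/
lemma iSupIndep_inf {K V ι κ : Type*} [Field K] [AddCommGroup V] [Module K V]
    {A : ι → Submodule K V} {B : κ → Submodule K V} (hA : iSupIndep A) (hB : iSupIndep B) :
    iSupIndep fun q : ι × κ => A q.1 ⊓ B q.2 := by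
  classical
  rw [iSupIndep_iff_finsetSum_eq_zero_imp_eq_zero]
  rintro s v hv h0 ⟨i, k⟩ hik
  have h1 := (iSupIndep_iff_finsetSum_eq_zero_imp_eq_zero A).mp hA (s.image Prod.fst)
    (fun i => ∑ q ∈ s with q.1 = i, v q) (fun i _ => sum_mem fun q hq => ?_) ?_ i
    (Finset.mem_image_of_mem _ hik)
  · have h2 := (iSupIndep_iff_finsetSum_eq_zero_imp_eq_zero B).mp hB
      ((s.filter (·.1 = i)).image Prod.snd) (fun k => v (i, k)) (fun k hk => ?_) ?_ k
      (Finset.mem_image.mpr ⟨(i, k), Finset.mem_filter.mpr ⟨hik, rfl⟩, rfl⟩)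
    · exact h2
    · obtain ⟨⟨i', k'⟩, hq, rfl⟩ := Finset.mem_image.mp hk
      obtain ⟨hqs, rfl⟩ := Finset.mem_filter.mp hq
      exact (hv _ hqs).2
    · rw [← h1, Finset.sum_image]
      · refine Finset.sum_congr rfl fun q hq => ?_
        rw [← (Finset.mem_filter.mp hq).2]
      · intro q hq q' hq' h
        exact Prod.ext ((Finset.mem_filter.mp hq).2.trans (Finset.mem_filter.mp hq').2.symm) h
  · obtain ⟨hqs, rfl⟩ := Finset.mem_filter.mp hq
    exact (hv _ hqs).1
  · rw [← h0]
    exact Finset.sum_fiberwise_of_maps_to (fun q hq => Finset.mem_image_of_mem _ hq) v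

namespace GrMod

variable {M N P Q : GrMod}

/-! ### Morphisms, submodules and quotients -/

/-- The composition of degree zero maps between modules in arbitrary universes. -/
def Hom.then (f : Hom M N) (g : Hom N P) : Hom M P :=
  ⟨g.toLieHom.comp f.toLieHom, fun p v hv => g.map_deg p _ (f.map_deg p v hv)⟩

@[simp] lemma Hom.then_apply (f : Hom M N) (g : Hom N P) (v : M) :
    (f.then g).toLieHom v = g.toLieHom (f.toLieHom v) := rfl

lemma mem_wt {μ : ℤ} {v : M} : v ∈ M.wt μ ↔ ⁅cur slH 0, v⁆ = (μ : ℂ) • v := Iff.rfl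

lemma map_mem_wt (f : M →ₗ⁅ℂ, Cur⁆ N) {μ : ℤ} {v : M} (hv : v ∈ M.wt μ) : f v ∈ N.wt μ := by
  rw [mem_wt] at hv ⊢
  rw [← LieModuleHom.map_lie, hv, map_smul]

lemma iSupIndep_wt (M : GrMod) : iSupIndep M.wt := by
  have h : M.wt = fun μ : ℤ => (LieModule.toEnd ℂ Cur M (cur slH 0)).eigenspace (μ : ℂ) := by
    ext μ v
    rw [mem_wt, Module.End.mem_eigenspace_iff]
    rfl
  rw [h]
  exact (Module.End.eigenspaces_iSupIndep _).comp Int.cast_injective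

/-- The bihomogeneous pieces `V[p] ∩ V_μ`. -/
def bideg (M : GrMod) (q : ℤ × ℤ) : Submodule ℂ M := M.deg q.1 ⊓ M.wt q.2

lemma IsGraded.iSupIndep_bideg (hM : M.IsGraded) : iSupIndep M.bideg :=
  iSupIndep_inf hM.isInternal.submodule_iSupIndep M.iSupIndep_wt

/-- `V` is spanned by bihomogeneous elements. -/
def IsBispanned (M : GrMod) : Prop := ⨆ q, M.bideg q = ⊤

lemma map_mem_bideg (f : Hom M N) {q : ℤ × ℤ} {v : M} (hv : v ∈ M.bideg q) :
    f.toLieHom v ∈ N.bideg q :=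
  ⟨f.map_deg _ _ hv.1, map_mem_wt _ hv.2⟩

lemma IsBispanned.exists_bideg (hM : M.IsBispanned) (hN : iSupIndep N.bideg) (f : Hom M N)
    {q : ℤ × ℤ} {v : M} (hv : f.toLieHom v ∈ N.bideg q) :
    ∃ m ∈ M.bideg q, f.toLieHom m = f.toLieHom v :=
  exists_mem_map_eq_of_iSupIndep (f.toLieHom : M →ₗ[ℂ] N) hN
    (fun _ _ ha => map_mem_bideg f ha) (by rw [hM]; trivial) hv

lemma IsBispanned.exists_wt (hM : M.IsBispanned) (f : M →ₗ⁅ℂ, Cur⁆ N)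
    {μ : ℤ} {v : M} (hv : f v ∈ N.wt μ) : ∃ m ∈ M.wt μ, f m = f v :=
  exists_mem_map_eq_of_iSupIndep (f : M →ₗ[ℂ] N) N.iSupIndep_wt
    (fun _ _ ha => map_mem_wt f ha) (by
      have h : (⨆ q, M.bideg q) ≤ ⨆ μ, M.wt μ :=
        iSup_le fun q => inf_le_right.trans (le_iSup M.wt q.2)
      rw [hM] at h
      exact h trivial) hv

lemma IsBispanned.exists_deg (hM : M.IsBispanned) (hN : N.IsGraded) (f : Hom M N)
    {p : ℤ} {v : M} (hv : f.toLieHom v ∈ N.deg p) :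
    ∃ m ∈ M.deg p, f.toLieHom m = f.toLieHom v :=
  exists_mem_map_eq_of_iSupIndep (f.toLieHom : M →ₗ[ℂ] N) hN.isInternal.submodule_iSupIndep
    f.map_deg (by
      have h : (⨆ q, M.bideg q) ≤ ⨆ p, M.deg p :=
        iSup_le fun q => inf_le_left.trans (le_iSup M.deg q.1)
      rw [hM] at h
      exact h trivial) hv

/-- The elements `a ⊗ 1` preserve degrees, so `V[p]` is a finite-dimensional representation of `sl₂`
and `integralPart_eq_top` applies. -/
lemma IsGraded.deg_le_iSup_bideg (hM : M.IsGraded) {p : ℤ} (hp : FiniteDimensional ℂ (M.deg p)) :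
    M.deg p ≤ ⨆ μ, M.bideg (p, μ) := by
  have key : ∀ (a : Sl2) (v : M), v ∈ M.deg p → ⁅cur a 0, v⁆ ∈ M.deg p := fun a v hv => by
    simpa using hM.lie_mem a 0 p v hv
  let _ : LieRingModule Sl2 (M.deg p) :=
    { bracket := fun a v => ⟨⁅cur a 0, v.1⁆, key a v v.2⟩
      add_lie := fun a b v => Subtype.ext (by
        change ⁅cur (a + b) 0, v.1⁆ = ⁅cur a 0, v.1⁆ + ⁅cur b 0, v.1⁆
        rw [cur_add, add_lie])
      lie_add := fun a v w => Subtype.ext (lie_add (cur a 0) v.1 w.1)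
      leibniz_lie := fun a b v => Subtype.ext (by
        change ⁅cur a 0, ⁅cur b 0, v.1⁆⁆ = ⁅cur ⁅a, b⁆ 0, v.1⁆ + ⁅cur b 0, ⁅cur a 0, v.1⁆⁆
        rw [leibniz_lie, lie_cur]) }
  let _ : LieModule ℂ Sl2 (M.deg p) :=
    { smul_lie := fun c a v => Subtype.ext (cur_smul_lie c a 0 v.1)
      lie_smul := fun c a v => Subtype.ext (lie_smul c (cur a 0) v.1) }
  intro v hv
  have hmem : (⟨v, hv⟩ : M.deg p) ∈ ⨆ n : ℤ, hEig (M.deg p) (n : ℂ) := by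
    change _ ∈ integralPart (M.deg p)
    rw [integralPart_eq_top]
    trivial
  have := Submodule.mem_map_of_mem (f := (M.deg p).subtype) hmem
  rw [Submodule.map_iSup] at this
  have hle : ⨆ n : ℤ, (hEig (M.deg p) (n : ℂ)).map (M.deg p).subtype ≤ ⨆ μ, M.bideg (p, μ) := by
    refine iSup_mono fun μ => ?_
    rintro _ ⟨w, hw, rfl⟩
    exact ⟨w.2, congrArg Subtype.val (mem_hEig.mp hw)⟩
  exact hle this

lemma IsBdd.isBispanned (hM : M.IsBdd) : M.IsBispanned := by
  rw [IsBispanned, eq_top_iff, ← hM.isInternal.submodule_iSup_eq_top]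
  exact iSup_le fun p => (hM.deg_le_iSup_bideg (hM.finiteDimensional p)).trans
    (iSup_le fun μ => le_iSup M.bideg (p, μ))

/-- A submodule, with the induced grading. -/
def sub (M : GrMod) (A : LieSubmodule ℂ Cur M) : GrMod where
  carrier := A
  deg p := (M.deg p).comap A.toSubmodule.subtype

/-- A quotient, with the induced grading. -/
def quot (M : GrMod) (A : LieSubmodule ℂ Cur M) : GrMod where
  carrier := M ⧸ A
  deg p := (M.deg p).map (LieSubmodule.Quotient.mk' A : M →ₗ[ℂ] M ⧸ A)

/-- The inclusion of a submodule. -/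
def inclHom (A : LieSubmodule ℂ Cur M) : Hom (M.sub A) M := ⟨A.incl, fun _ _ hv => hv⟩

lemma inclHom_injective (A : LieSubmodule ℂ Cur M) :
    Function.Injective (inclHom A).toLieHom := Subtype.val_injective

/-- The projection to a quotient. -/
def mkHom (A : LieSubmodule ℂ Cur M) : Hom M (M.quot A) :=
  ⟨LieSubmodule.Quotient.mk' A, fun _ v hv => ⟨v, hv, rfl⟩⟩

lemma mkHom_surjective (A : LieSubmodule ℂ Cur M) : Function.Surjective (mkHom A).toLieHom :=
  LieSubmodule.Quotient.surjective_mk' A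

lemma mkHom_eq_zero {A : LieSubmodule ℂ Cur M} {v : M} : (mkHom A).toLieHom v = 0 ↔ v ∈ A :=
  LieSubmodule.Quotient.mk_eq_zero A

/-- The map into a submodule induced by a map with values in it. -/
def Hom.toSub (f : Hom M N) (A : LieSubmodule ℂ Cur N) (h : ∀ v, f.toLieHom v ∈ A) :
    Hom M (N.sub A) where
  toLieHom :=
    { (f.toLieHom : M →ₗ[ℂ] N).codRestrict A.toSubmodule h with
      map_lie' := fun {c v} => Subtype.ext (LieModuleHom.map_lie f.toLieHom c v) }
  map_deg p v hv := f.map_deg p v hv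

/-- The map out of a quotient induced by a map vanishing on the submodule. -/
def Hom.ofQuot (f : Hom M N) (A : LieSubmodule ℂ Cur M) (h : ∀ v ∈ A, f.toLieHom v = 0) :
    Hom (M.quot A) N where
  toLieHom :=
    { A.toSubmodule.liftQ (f.toLieHom : M →ₗ[ℂ] N) h with
      map_lie' := fun {c v} => by
        obtain ⟨v, rfl⟩ := LieSubmodule.Quotient.surjective_mk' A v
        exact LieModuleHom.map_lie f.toLieHom c v }
  map_deg p v hv := by
    obtain ⟨v, hv, rfl⟩ := hv
    exact f.map_deg p v hv

@[simp] lemma Hom.ofQuot_mk (f : Hom M N) (A : LieSubmodule ℂ Cur M)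
    (h : ∀ v ∈ A, f.toLieHom v = 0) (v : M) :
    (f.ofQuot A h).toLieHom ((mkHom A).toLieHom v) = f.toLieHom v := rfl

lemma IsGraded.sub (hM : M.IsGraded) {A : LieSubmodule ℂ Cur M} (hA : M.IsGradedSubmodule A) :
    (M.sub A).IsGraded where
  isInternal := by
    apply DirectSum.isInternal_submodule_of_iSupIndep_of_iSup_eq_top
    · rw [iSupIndep_iff_finsetSum_eq_zero_imp_eq_zero]
      intro s v hv h0 i hi
      refine Subtype.ext ((iSupIndep_iff_finsetSum_eq_zero_imp_eq_zero M.deg).mp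
        hM.isInternal.submodule_iSupIndep s (fun i => (v i).1) hv ?_ i hi)
      exact (map_sum A.toSubmodule.subtype v s).symm.trans (congrArg A.toSubmodule.subtype h0)
    · rw [eq_top_iff]
      rintro ⟨v, hv⟩ -
      have h := hA hv
      have h2 : (⨆ p, A.toSubmodule ⊓ M.deg p) =
          (⨆ p, (M.sub A).deg p).map A.toSubmodule.subtype := by
        refine Eq.trans ?_ (Submodule.map_iSup A.toSubmodule.subtype (M.sub A).deg).symm
        exact iSup_congr fun p => (Submodule.map_comap_subtype _ _).symm
      rw [h2] at h
      obtain ⟨w, hw, hwv⟩ := h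
      rwa [← show w = ⟨v, hv⟩ from Subtype.ext hwv]
  lie_mem a r s v hv := hM.lie_mem a r s v.1 hv

lemma IsBdd.sub (hM : M.IsBdd) {A : LieSubmodule ℂ Cur M} (hA : M.IsGradedSubmodule A) :
    (M.sub A).IsBdd where
  toIsGraded := hM.toIsGraded.sub hA
  deg_eq_bot := by
    obtain ⟨p₀, h⟩ := hM.deg_eq_bot
    refine ⟨p₀, fun p hp => (Submodule.eq_bot_iff _).mpr fun v hv => Subtype.ext ?_⟩
    have hv' : v.1 ∈ M.deg p := hv
    rwa [h p hp, Submodule.mem_bot] at hv'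
  finiteDimensional p := by
    have := hM.finiteDimensional p
    exact Module.Finite.of_injective
      ((A.toSubmodule.subtype.restrict fun v hv => hv : (M.sub A).deg p →ₗ[ℂ] M.deg p))
      fun v w h => Subtype.ext (Subtype.ext (congrArg (fun z : M.deg p => z.1) h))
  finite_wt := hM.finite_wt.subset fun μ hμ => by
    obtain ⟨v, hv, hv0⟩ := (Submodule.ne_bot_iff _).mp hμ
    exact (Submodule.ne_bot_iff _).mpr ⟨v.1, map_mem_wt (inclHom A).toLieHom hv,
      fun h => hv0 (Subtype.ext h)⟩

lemma IsGraded.quot (hM : M.IsGraded) {A : LieSubmodule ℂ Cur M} (hA : M.IsGradedSubmodule A) :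
    (M.quot A).IsGraded where
  isInternal := by
    apply DirectSum.isInternal_submodule_of_iSupIndep_of_iSup_eq_top
    · exact iSupIndep_map_mkQ hM.isInternal.submodule_iSupIndep hA
    · change (⨆ p, (M.deg p).map (LieSubmodule.Quotient.mk' A : M →ₗ[ℂ] M ⧸ A)) = ⊤
      rw [← Submodule.map_iSup, hM.isInternal.submodule_iSup_eq_top, Submodule.map_top]
      exact LinearMap.range_eq_top.mpr (LieSubmodule.Quotient.surjective_mk' A)
  lie_mem a r s v hv := by
    obtain ⟨v, hv, rfl⟩ := hv
    exact ⟨⁅cur a r, v⁆, hM.lie_mem a r s v hv, rfl⟩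

lemma IsBdd.quot (hM : M.IsBdd) {A : LieSubmodule ℂ Cur M} (hA : M.IsGradedSubmodule A) :
    (M.quot A).IsBdd where
  toIsGraded := hM.toIsGraded.quot hA
  deg_eq_bot := by
    obtain ⟨p₀, h⟩ := hM.deg_eq_bot
    refine ⟨p₀, fun p hp => ?_⟩
    change (M.deg p).map _ = ⊥
    rw [h p hp, Submodule.map_bot]
  finiteDimensional p := by
    have := hM.finiteDimensional p
    exact inferInstanceAs (FiniteDimensional ℂ
      ((M.deg p).map (LieSubmodule.Quotient.mk' A : M →ₗ[ℂ] M ⧸ A)))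
  finite_wt := hM.finite_wt.subset fun μ hμ => by
    obtain ⟨v, hv, hv0⟩ := (Submodule.ne_bot_iff _).mp hμ
    obtain ⟨m, rfl⟩ := mkHom_surjective A v
    obtain ⟨w, hw, h⟩ := hM.isBispanned.exists_wt (mkHom A).toLieHom hv
    refine (Submodule.ne_bot_iff _).mpr ⟨w, hw, fun h0 => hv0 ?_⟩
    rw [← h, h0, map_zero]

/-! ### The submodule generated by a weight space -/

/-- The submodule generated by the weight space `V_μ`. -/
def top (M : GrMod) (μ : ℤ) : LieSubmodule ℂ Cur M := LieSubmodule.lieSpan ℂ Cur (M.wt μ : Set M)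

lemma wt_le_top {μ : ℤ} {v : M} (hv : v ∈ M.wt μ) : v ∈ M.top μ := LieSubmodule.subset_lieSpan hv

lemma map_mem_top (f : M →ₗ⁅ℂ, Cur⁆ N) {μ : ℤ} {v : M} (hv : v ∈ M.top μ) : f v ∈ N.top μ := by
  have : M.top μ ≤ (N.top μ).comap f :=
    LieSubmodule.lieSpan_le.mpr fun v hv => wt_le_top (map_mem_wt f hv)
  exact this hv

/-- The span of the homogeneous elements of a submodule. -/
def homogeneousPart (hM : M.IsGraded) (A : LieSubmodule ℂ Cur M) : LieSubmodule ℂ Cur M where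
  __ := ⨆ p : ℤ, A.toSubmodule ⊓ M.deg p
  lie_mem {c v} hv := by
    refine lie_mem_of_cur (S := ⨆ p : ℤ, A.toSubmodule ⊓ M.deg p) (fun a r => ?_) c
    change v ∈ ⨆ p : ℤ, A.toSubmodule ⊓ M.deg p at hv
    induction hv using Submodule.iSup_induction' with
    | zero => rw [lie_zero]; exact zero_mem _
    | add u v _ _ hu hv => rw [lie_add]; exact add_mem hu hv
    | mem p v hv =>
      exact Submodule.mem_iSup_of_mem (r + p) ⟨A.lie_mem hv.1, hM.lie_mem a r p v hv.2⟩

/-- Since `h ⊗ 1` has degree zero, the kernel of `h ⊗ 1 - μ` is graded. -/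
lemma IsGraded.mem_iSup_deg_inf_wt (hM : M.IsGraded) {μ : ℤ} {v : M} (hv : v ∈ M.wt μ) :
    v ∈ ⨆ p, M.deg p ⊓ M.wt μ := by
  have := mem_iSup_inf_ker_of_iSupIndep
    (LieModule.toEnd ℂ Cur M (cur slH 0) - (μ : ℂ) • (1 : Module.End ℂ M))
    (A := M.deg) (B := M.deg) hM.isInternal.submodule_iSupIndep (fun p a ha => ?_) (v := v)
    (by rw [hM.isInternal.submodule_iSup_eq_top]; trivial) ?_
  · refine SetLike.le_def.mp (iSup_mono fun p w hw => ⟨hw.1, ?_⟩) this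
    replace hw := hw.2
    exact sub_eq_zero.mp (LinearMap.mem_ker.mp hw)
  · refine sub_mem ?_ (Submodule.smul_mem _ _ ha)
    simpa using hM.lie_mem slH 0 p a ha
  · rw [LinearMap.sub_apply, sub_eq_zero]
    exact hv

/-- The homogeneous part of `M.top μ` is a submodule that contains the generating weight space. -/
lemma IsGraded.top (hM : M.IsGraded) (μ : ℤ) : M.IsGradedSubmodule (M.top μ) := by
  have : M.top μ ≤ homogeneousPart hM (M.top μ) := LieSubmodule.lieSpan_le.mpr fun v hv =>
    (iSup_mono fun p => le_inf (fun w hw => wt_le_top hw.2) inf_le_left :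
      (⨆ p, M.deg p ⊓ M.wt μ) ≤ ⨆ p, (M.top μ).toSubmodule ⊓ M.deg p)
      (hM.mem_iSup_deg_inf_wt hv)
  exact this

/-! ### Direct sums -/

section DirectSum

variable {ι : Type*} {N : ι → GrMod}

/-- The projections of a direct sum. -/
def projHom (N : ι → GrMod) (i : ι) : Hom (directSum N) (N i) where
  toLieHom := DirectSum.lieModuleComponent ℂ ι Cur (fun i => (N i).carrier) i
  map_deg _ _ hv := hv i

lemma directSum_ext {v w : directSum N}
    (h : ∀ i, (projHom N i).toLieHom v = (projHom N i).toLieHom w) : v = w :=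
  DFinsupp.ext h

open Classical in
/-- The inclusions into a direct sum. -/
def ofHom (N : ι → GrMod) (i : ι) : Hom (N i) (directSum N) where
  toLieHom := DirectSum.lieModuleOf ℂ ι Cur (fun i => (N i).carrier) i
  map_deg _ _ hv j := by
    change DirectSum.of (fun i => (N i).carrier) i _ j ∈ _
    by_cases h : i = j
    · subst h
      rwa [DirectSum.of_eq_same]
    · rw [DirectSum.of_eq_of_ne _ _ _ (Ne.symm h)]
      exact zero_mem _

lemma projHom_ofHom_same (i : ι) (v : N i) :
    (projHom N i).toLieHom ((ofHom N i).toLieHom v) = v := by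
  classical
  exact DirectSum.of_eq_same (β := fun i => (N i).carrier) i v

lemma projHom_ofHom_ne {i j : ι} (h : i ≠ j) (v : N i) :
    (projHom N j).toLieHom ((ofHom N i).toLieHom v) = 0 := by
  classical
  exact DirectSum.of_eq_of_ne (β := fun i => (N i).carrier) _ _ _ (Ne.symm h)

lemma directSum_induction {C : directSum N → Prop} (v : directSum N) (h0 : C 0)
    (hof : ∀ i v, C ((ofHom N i).toLieHom v)) (hadd : ∀ v w, C v → C w → C (v + w)) : C v := by
  classical
  exact DirectSum.induction_on (β := fun i => (N i).carrier) v h0 hof hadd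

open Classical in
/-- The map out of a direct sum induced by maps out of the summands. -/
def descHom (f : ∀ i, Hom (N i) P) : Hom (directSum N) P where
  toLieHom :=
    { DirectSum.toModule ℂ ι P.carrier (fun i => ((f i).toLieHom : N i →ₗ[ℂ] P)) with
      map_lie' := fun {c v} => by
        change DirectSum.toModule ℂ ι P.carrier (fun i => ((f i).toLieHom : N i →ₗ[ℂ] P))
          (⁅c, (v : directSum N)⁆ : directSum N) =
          ⁅c, DirectSum.toModule ℂ ι P.carrier (fun i => ((f i).toLieHom : N i →ₗ[ℂ] P)) v⁆
        refine directSum_induction (N := N) (C := fun v =>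
          DirectSum.toModule ℂ ι P.carrier (fun i => ((f i).toLieHom : N i →ₗ[ℂ] P))
            (⁅c, (v : directSum N)⁆ : directSum N) = ⁅c, DirectSum.toModule ℂ ι P.carrier
              (fun i => ((f i).toLieHom : N i →ₗ[ℂ] P)) v⁆) v ?_ (fun i v => ?_) fun v w hv hw => ?_
        · rw [lie_zero]
          refine (map_zero _).trans ((lie_zero c).symm.trans (congrArg _ ?_))
          exact (map_zero (DirectSum.toModule ℂ ι P.carrier
            fun i => ((f i).toLieHom : N i →ₗ[ℂ] P))).symm
        · rw [← LieModuleHom.map_lie]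
          exact (DirectSum.toModule_lof ℂ i _).trans ((LieModuleHom.map_lie _ _ _).trans
            (congrArg _ (DirectSum.toModule_lof ℂ
              (φ := fun i => ((f i).toLieHom : N i →ₗ[ℂ] P)) i v).symm))
        · rw [lie_add]
          exact (map_add _ _ _).trans ((congrArg₂ _ hv hw).trans
            ((lie_add _ _ _).symm.trans (congrArg _ (map_add _ _ _).symm))) }
  map_deg p v hv := by
    change DirectSum.toModule ℂ ι P.carrier (fun i => ((f i).toLieHom : N i →ₗ[ℂ] P)) v ∈ _
    have : v = ∑ i ∈ DFinsupp.support (show DirectSum ι fun i => (N i).carrier from v),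
        DirectSum.of (fun i => (N i).carrier) i
          ((show DirectSum ι fun i => (N i).carrier from v) i) :=
      (DirectSum.sum_support_of _).symm
    rw [this, map_sum]
    refine sum_mem fun i _ => ?_
    have h := DirectSum.toModule_lof ℂ (φ := fun i => ((f i).toLieHom : N i →ₗ[ℂ] P)) i
      ((show DirectSum ι fun i => (N i).carrier from v) i)
    change DirectSum.toModule ℂ ι P.carrier (fun i => ((f i).toLieHom : N i →ₗ[ℂ] P))
      (DirectSum.lof ℂ ι _ i _) ∈ _
    rw [h]
    exact (f i).map_deg p _ (hv i)

@[simp] lemma descHom_ofHom (f : ∀ i, Hom (N i) P) (i : ι) (v : N i) :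
    (descHom f).toLieHom ((ofHom N i).toLieHom v) = (f i).toLieHom v := by
  classical
  exact DirectSum.toModule_lof ℂ (φ := fun i => ((f i).toLieHom : N i →ₗ[ℂ] P)) i v

lemma directSum_hom_ext {f g : directSum N →ₗ⁅ℂ, Cur⁆ P}
    (h : ∀ i v, f ((ofHom N i).toLieHom v) = g ((ofHom N i).toLieHom v)) (v : directSum N) :
    f v = g v := by
  refine directSum_induction (C := fun v => f v = g v) v ?_ h fun v w hv hw => ?_
  · rw [map_zero, map_zero]
  · rw [map_add, map_add, hv, hw]

lemma directSum_subsingleton (h : ∀ i, Subsingleton (N i)) : Subsingleton (directSum N) :=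
  ⟨fun _ _ => directSum_ext fun i => (h i).elim _ _⟩

lemma IsBispanned.directSum (h : ∀ i, (N i).IsBispanned) : (directSum N).IsBispanned := by
  rw [IsBispanned, eq_top_iff]
  intro v _
  refine directSum_induction v (zero_mem _) (fun i v => ?_) fun v w hv hw => add_mem hv hw
  have hv : v ∈ ⨆ q, (N i).bideg q := by rw [h i]; trivial
  induction hv using Submodule.iSup_induction' with
  | zero => rw [map_zero]; exact zero_mem _
  | add u v _ _ hu hv => rw [map_add]; exact add_mem hu hv
  | mem q v hv => exact Submodule.mem_iSup_of_mem q (map_mem_bideg (ofHom N i) hv)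

end DirectSum

end GrMod

end CurrentSl2

end

noncomputable section

namespace CurrentSl2

open LieModule

namespace GrMod

variable {M N P : GrMod}

/-! ### Highest weight vectors and local nilpotency -/

/-- The action raises degrees as in a graded representation. -/
def LieDeg (M : GrMod) : Prop :=
  ∀ (a : Sl2) (r : ℕ) (s : ℤ) (v : M), v ∈ M.deg s → ⁅cur a r, v⁆ ∈ M.deg (r + s)

/-- The action of `y ⊗ 1`. -/
abbrev actY (M : GrMod) : Module.End ℂ M := toEnd ℂ Cur M (cur slY 0)

/-- `y ⊗ 1` acts locally nilpotently. -/
def LocNil (M : GrMod) : Prop := ∀ v : M, ∃ k, (M.actY ^ k) v = 0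

/-- All weights are at most `n`. -/
def WtLE (M : GrMod) (n : ℤ) : Prop := ∀ μ, n < μ → M.wt μ = ⊥

lemma actY_pow_succ (k : ℕ) (v : M) : (M.actY ^ (k + 1)) v = ⁅cur slY 0, (M.actY ^ k) v⁆ := by
  rw [pow_succ', Module.End.mul_apply, toEnd_apply_apply]

lemma curX_mem_wt {μ : ℤ} {v : M} (hv : v ∈ M.wt μ) (r : ℕ) :
    ⁅cur slX r, v⁆ ∈ M.wt (μ + 2) := by
  rw [mem_wt] at hv ⊢
  rw [curH_curX, hv, lie_smul, zero_add, ← add_smul]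
  push_cast; rfl

lemma curH_mem_wt {μ : ℤ} {v : M} (hv : v ∈ M.wt μ) (r : ℕ) : ⁅cur slH r, v⁆ ∈ M.wt μ := by
  rw [mem_wt] at hv ⊢
  rw [curH_curH, hv, lie_smul]

lemma curY_mem_wt {μ : ℤ} {v : M} (hv : v ∈ M.wt μ) (r : ℕ) :
    ⁅cur slY r, v⁆ ∈ M.wt (μ - 2) := by
  rw [mem_wt] at hv ⊢
  rw [curH_curY, hv, lie_smul, zero_add, ← sub_smul]
  push_cast; rfl

lemma actY_pow_mem_wt {μ : ℤ} {v : M} (hv : v ∈ M.wt μ) (k : ℕ) :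
    (M.actY ^ k) v ∈ M.wt (μ - 2 * k) := by
  induction k with
  | zero => simpa using hv
  | succ k ih =>
    rw [actY_pow_succ]
    convert curY_mem_wt ih 0 using 2
    push_cast; ring

lemma curX_actY_pow {n : ℤ} {v : M} (hv : v ∈ M.wt n) (hx : ⁅cur slX 0, v⁆ = 0) (k : ℕ) :
    ⁅cur slX 0, (M.actY ^ (k + 1)) v⁆ = (((k : ℂ) + 1) * (n - k)) • (M.actY ^ k) v := by
  induction k with
  | zero =>
    rw [actY_pow_succ, pow_zero, Module.End.one_apply, curX_curY, hx, lie_zero, zero_add]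
    rw [mem_wt] at hv
    simpa using hv
  | succ k ih =>
    have := mem_wt.mp (actY_pow_mem_wt hv (k + 1))
    rw [actY_pow_succ, curX_curY, ih, lie_smul, ← actY_pow_succ, add_zero, this, ← add_smul]
    congr 1
    push_cast
    ring

/-- If `yⁿ⁺¹ v ≠ 0`, apply `x` to the first power that vanishes after it: the coefficient in
`curX_actY_pow` is nonzero there. The last defining relation of `W(n)` is thus automatic. -/
lemma LocNil.actY_pow_eq_zero (hM : M.LocNil) {n : ℕ} {v : M} (hv : v ∈ M.wt n)
    (hx : ⁅cur slX 0, v⁆ = 0) : (M.actY ^ (n + 1)) v = 0 := by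
  by_contra hne
  obtain ⟨k, hk⟩ := hM v
  obtain ⟨j, hj, hj'⟩ := Nat.exists_not_and_succ_of_not_zero_of_exists
    (p := fun k => (M.actY ^ (n + 1 + k)) v = 0) hne ⟨k, by
      rw [pow_add, Module.End.mul_apply, hk, map_zero]⟩
  have h := curX_actY_pow hv hx (n + 1 + j)
  rw [add_assoc (n + 1) j 1, hj', lie_zero, eq_comm, smul_eq_zero_iff_left hj, mul_eq_zero] at h
  rcases h with h | h
  · exact Nat.cast_add_one_ne_zero _ h
  · push_cast at h
    have : ((j + 1 : ℕ) : ℂ) = 0 := by push_cast; linear_combination -h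
    exact absurd this (Nat.cast_ne_zero.mpr (by positivity))

lemma map_actY_pow (f : M →ₗ⁅ℂ, Cur⁆ N) (k : ℕ) (v : M) :
    f ((M.actY ^ k) v) = (N.actY ^ k) (f v) := by
  induction k with
  | zero => simp
  | succ k ih => rw [actY_pow_succ, actY_pow_succ, LieModuleHom.map_lie, ih]

lemma exists_actY_pow_add {v w : M} (hv : ∃ k, (M.actY ^ k) v = 0)
    (hw : ∃ k, (M.actY ^ k) w = 0) : ∃ k, (M.actY ^ k) (v + w) = 0 := by
  obtain ⟨k, hk⟩ := hv
  obtain ⟨l, hl⟩ := hw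
  refine ⟨k + l, ?_⟩
  rw [map_add]
  nth_rw 1 [add_comm k l]
  rw [pow_add, pow_add, Module.End.mul_apply, Module.End.mul_apply, hk, hl, map_zero, map_zero,
    add_zero]

lemma LocNil.directSum {ι : Type*} {N : ι → GrMod} (h : ∀ i, (N i).LocNil) :
    (directSum N).LocNil := fun v => by
  refine directSum_induction (C := fun v => ∃ k, ((GrMod.directSum N).actY ^ k) v = 0) v
    ⟨0, by simp⟩ (fun i v => ?_) fun v w => exists_actY_pow_add
  obtain ⟨k, hk⟩ := h i v
  exact ⟨k, by rw [← map_actY_pow, hk, map_zero]⟩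

lemma WtLE.directSum {ι : Type*} {N : ι → GrMod} {n : ℤ} (h : ∀ i, (N i).WtLE n) :
    (directSum N).WtLE n := fun μ hμ => by
  rw [Submodule.eq_bot_iff]
  intro v hv
  refine directSum_ext fun i => ?_
  have := map_mem_wt (projHom N i).toLieHom hv
  rw [h i μ hμ, Submodule.mem_bot] at this
  rw [this, map_zero]

lemma LieDeg.directSum {ι : Type*} {N : ι → GrMod} (h : ∀ i, (N i).LieDeg) :
    (directSum N).LieDeg := fun a r s v hv i => by
  have : (projHom N i).toLieHom ⁅cur a r, v⁆ ∈ (N i).deg (r + s) := by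
    rw [LieModuleHom.map_lie]
    exact h i a r s _ (hv i)
  exact this

/-- A weight vector not killed by any power of `y ⊗ 1` would produce infinitely many weights `μ -
2k`. -/
lemma IsBdd.locNil (hM : M.IsBdd) : M.LocNil := fun v => by
  have hv : v ∈ ⨆ q, M.bideg q := by rw [hM.isBispanned]; trivial
  induction hv using Submodule.iSup_induction' with
  | zero => exact ⟨0, by simp⟩
  | add u v _ _ hu hv => exact exists_actY_pow_add hu hv
  | mem q v hv =>
    by_contra! h
    have : Set.range (fun k : ℕ => q.2 - 2 * (k : ℤ)) ⊆ {μ | M.wt μ ≠ ⊥} := by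
      rintro _ ⟨k, rfl⟩
      exact (Submodule.ne_bot_iff _).mpr ⟨_, actY_pow_mem_wt hv.2 k, h k⟩
    exact Set.infinite_range_of_injective (fun a b hab => by
      simpa using hab) (hM.finite_wt.subset this)

/-- If the bihomogeneous elements of weight `≤ n` span, then all weights are at most `n`. -/
lemma isBispanned_and_wtLE {n : ℤ}
    (h : ∀ v : M, v ∈ Submodule.span ℂ {v | ∃ q : ℤ × ℤ, q.2 ≤ n ∧ v ∈ M.bideg q}) :
    M.IsBispanned ∧ M.WtLE n := by
  constructor
  · rw [IsBispanned, eq_top_iff]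
    intro v _
    refine Submodule.span_le.mpr ?_ (h v)
    rintro v ⟨q, -, hv⟩
    exact Submodule.mem_iSup_of_mem q hv
  · intro μ hμ
    rw [Submodule.eq_bot_iff]
    intro v hv
    -- The weight spaces above `n` are replaced by zero; this truncated family still spans, so the
    -- component of `v` of weight `μ > n` is zero.
    obtain ⟨a, ha, hav⟩ := exists_mem_map_eq_of_iSupIndep (LinearMap.id : M →ₗ[ℂ] M)
      (A := fun μ : ℤ => if μ ≤ n then M.wt μ else ⊥) M.iSupIndep_wt (fun i a ha => by
        split_ifs at ha
        · exact ha
        · rw [(Submodule.mem_bot ℂ).mp ha]; exact zero_mem _) (v := v) (i := μ) (by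
        refine Submodule.span_le.mpr ?_ (h v)
        rintro v ⟨q, hq, hv⟩
        refine Submodule.mem_iSup_of_mem q.2 ?_
        rw [if_pos hq]
        exact hv.2) hv
    rw [if_neg hμ.not_ge, Submodule.mem_bot] at ha
    rw [← LinearMap.id_apply (R := ℂ) v, ← hav, ha, map_zero]

end GrMod

open GrMod

/-! ### The enveloping algebra and global Weyl modules -/

/-- The elements whose left multiplication preserves `S` form a subalgebra containing the image of
`Cur`. By the universal property the identity of `U` factors through it, so it is all of `U`. -/
lemma mem_of_inU_mul_mem {S : Submodule ℂ U} (h1 : (1 : U) ∈ S)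
    (h : ∀ a r, ∀ u ∈ S, inU (cur a r) * u ∈ S) (u : U) : u ∈ S := by
  let A : Subalgebra ℂ U :=
    { carrier := {u | ∀ v ∈ S, u * v ∈ S}
      mul_mem' := fun ha hb v hv => by rw [mul_assoc]; exact ha _ (hb v hv)
      add_mem' := fun ha hb v hv => by rw [add_mul]; exact add_mem (ha v hv) (hb v hv)
      algebraMap_mem' := fun c v hv => by
        rw [← Algebra.smul_def]; exact S.smul_mem c hv }
  have hA : ∀ c : Cur, inU c ∈ A := fun c v hv =>
    mem_of_cur_mem (S := S.comap ((LinearMap.mulRight ℂ v) ∘ₗ (inU : Cur →ₗ[ℂ] U)))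
      (fun a r => h a r v hv) c
  let f : Cur →ₗ⁅ℂ⁆ A :=
    { toFun := fun c => ⟨inU c, hA c⟩
      map_add' := fun a b => Subtype.ext (map_add inU a b)
      map_smul' := fun c a => Subtype.ext (map_smul inU c a)
      map_lie' := fun {a b} => Subtype.ext (LieHom.map_lie inU a b) }
  have hf : A.val.comp (UniversalEnvelopingAlgebra.lift ℂ f) = AlgHom.id ℂ U := by
    apply UniversalEnvelopingAlgebra.hom_ext
    ext c
    simp [f]
  have hu := (UniversalEnvelopingAlgebra.lift ℂ f u).2 1 h1
  rw [mul_one] at hu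
  have h2 := DFunLike.congr_fun hf u
  rw [AlgHom.comp_apply, AlgHom.id_apply, Subalgebra.val_apply] at h2
  rwa [h2] at hu

variable {n : ℕ} {r : ℤ}

/-- The map `u ↦ u wₙ`. -/
def wmk (n : ℕ) (r : ℤ) : U →ₗ[ℂ] weyl n r := (weylIdeal n).mkQ.restrictScalars ℂ

lemma wmk_surjective : Function.Surjective (wmk n r) := (weylIdeal n).mkQ_surjective

lemma wmk_eq_zero {u : U} : wmk n r u = 0 ↔ u ∈ weylIdeal n := Submodule.Quotient.mk_eq_zero _

lemma lie_wmk (c : Cur) (u : U) : ⁅c, wmk n r u⁆ = wmk n r (inU c * u) := by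
  change inU c • (weylIdeal n).mkQ u = (weylIdeal n).mkQ _
  rw [← map_smul, smul_eq_mul]

/-- The generator `wₙ` of `W(n, r)`. -/
def wgen (n : ℕ) (r : ℤ) : weyl n r := wmk n r 1

lemma lie_wgen (c : Cur) : ⁅c, wgen n r⁆ = wmk n r (inU c) := by
  rw [wgen, lie_wmk, mul_one]

lemma wgen_mem_deg : wgen n r ∈ (weyl n r).deg r := by
  refine ⟨1, Submodule.subset_span ⟨[], ?_, ?_⟩, rfl⟩ <;> simp

lemma curX_wgen (s : ℕ) : ⁅cur slX s, wgen n r⁆ = 0 := by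
  rw [lie_wgen, wmk_eq_zero]
  exact Submodule.subset_span (Or.inl ⟨s, rfl⟩)

lemma wgen_mem_wt : wgen n r ∈ (weyl n r).wt n := by
  have h : wmk n r (inU (cur slH 0) - algebraMap ℂ U n) = 0 :=
    wmk_eq_zero.mpr (Submodule.subset_span (Or.inr (Or.inl rfl)))
  rw [map_sub, sub_eq_zero, Algebra.algebraMap_eq_smul_one, map_smul] at h
  rw [mem_wt, Int.cast_natCast, lie_wgen, h, wgen]

lemma actY_pow_wgen_eq_wmk (k : ℕ) :
    ((weyl n r).actY ^ k) (wgen n r) = wmk n r (inU (cur slY 0) ^ k) := by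
  induction k with
  | zero => rw [pow_zero, pow_zero, Module.End.one_apply, wgen]
  | succ k ih => rw [actY_pow_succ, ih, pow_succ', lie_wmk]

lemma actY_pow_wgen : ((weyl n r).actY ^ (n + 1)) (wgen n r) = 0 := by
  rw [actY_pow_wgen_eq_wmk, wmk_eq_zero]
  exact Submodule.subset_span (Or.inr (Or.inr rfl))

lemma weyl_induction {S : Submodule ℂ (weyl n r)} (h1 : wgen n r ∈ S)
    (h : ∀ a s, ∀ v ∈ S, ⁅cur a s, v⁆ ∈ S) (v : weyl n r) : v ∈ S := by
  obtain ⟨u, rfl⟩ := wmk_surjective v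
  refine mem_of_inU_mul_mem (S := S.comap (wmk n r)) h1 (fun a s u hu => ?_) u
  rw [Submodule.mem_comap, ← lie_wmk]
  exact h a s _ hu

lemma weyl_deg_induction {C : ℤ → Submodule ℂ (weyl n r)} (h1 : wgen n r ∈ C r)
    (h : ∀ a (s : ℕ) k, ∀ v ∈ C k, ⁅cur a s, v⁆ ∈ C (s + k)) {p : ℤ} {v : weyl n r}
    (hv : v ∈ (weyl n r).deg p) : v ∈ C p := by
  obtain ⟨u, hu, rfl⟩ := hv
  have key : ∀ l : List (Sl2 × ℕ), wmk n r (l.map fun q => inU (cur q.1 q.2)).prod ∈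
      C ((l.map Prod.snd).sum + r : ℤ) := by
    intro l
    induction l with
    | nil => simpa [wgen] using h1
    | cons q l ih =>
      have := h q.1 q.2 _ _ ih
      rw [lie_wmk] at this
      simp only [List.map_cons, List.prod_cons, List.sum_cons, Nat.cast_add, add_assoc]
      exact this
  change u ∈ (C p).comap (wmk n r)
  refine Submodule.span_le.mpr ?_ hu
  rintro _ ⟨l, hl, rfl⟩
  have := key l
  rwa [hl, sub_add_cancel] at this

lemma weyl_lieDeg : (weyl n r).LieDeg := by
  rintro a s p _ ⟨u, hu, rfl⟩
  refine ⟨inU (cur a s) * u, ?_, (lie_wmk _ _).symm⟩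
  change u ∈ (degU (s + p - r)).comap (LinearMap.mulLeft ℂ (inU (cur a s)))
  refine Submodule.span_le.mpr ?_ hu
  rintro _ ⟨l, hl, rfl⟩
  refine Submodule.subset_span ⟨(a, s) :: l, ?_, ?_⟩
  · rw [List.map_cons, List.sum_cons, Nat.cast_add, hl, add_sub_assoc]
  · rw [List.map_cons, List.prod_cons, LinearMap.mulLeft_apply]

/-- The universal property of global Weyl modules. -/
def weylLift {V : GrMod} (hV : V.LieDeg) {b : V} (hd : b ∈ V.deg r) (hw : b ∈ V.wt n)
    (hx : ∀ s, ⁅cur slX s, b⁆ = 0) (hy : (V.actY ^ (n + 1)) b = 0) : Hom (weyl n r) V := by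
  let ρ : U →ₐ[ℂ] Module.End ℂ V := UniversalEnvelopingAlgebra.lift ℂ (toEnd ℂ Cur V)
  have hρ : ∀ c v, ρ (inU c) v = ⁅c, v⁆ := fun c v => by
    rw [UniversalEnvelopingAlgebra.lift_ι_apply, toEnd_apply_apply]
  let ann : Submodule U U :=
    { carrier := {u | ρ u b = 0}
      add_mem' := fun {u v} hu hv => by
        change ρ (u + v) b = 0
        rw [map_add, LinearMap.add_apply, hu, hv, add_zero]
      zero_mem' := by change ρ 0 b = 0; simp
      smul_mem' := fun u v hv => by
        change ρ (u * v) b = 0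
        rw [map_mul, Module.End.mul_apply, hv, map_zero] }
  have hann : weylIdeal n ≤ ann := by
    refine Submodule.span_le.mpr ?_
    rintro _ (⟨s, rfl⟩ | rfl | rfl)
    · exact (hρ _ _).trans (hx s)
    · change ρ (_ - _) b = 0
      rw [map_sub, LinearMap.sub_apply, hρ, hw, AlgHom.commutes, Module.algebraMap_end_apply]
      simp
    · change ρ (_ ^ _) b = 0
      have : ρ (inU (cur slY 0)) = V.actY := LinearMap.ext fun v => hρ _ v
      rw [map_pow, this, hy]
  let g : WeylCarrier n →ₗ[ℂ] V :=
    (((weylIdeal n).restrictScalars ℂ).liftQ ((LinearMap.applyₗ b : Module.End ℂ V →ₗ[ℂ] V) ∘ₗ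
      ρ.toLinearMap) hann) ∘ₗ (Submodule.Quotient.restrictScalarsEquiv ℂ (weylIdeal n)).symm
  have hg : ∀ c u, g ((weylIdeal n).mkQ (inU c * u)) = ⁅c, g ((weylIdeal n).mkQ u)⁆ := fun c u => by
    change ρ (inU c * u) b = ⁅c, ρ u b⁆
    rw [map_mul, Module.End.mul_apply, hρ]
  let g' : weyl n r →ₗ⁅ℂ, Cur⁆ V :=
    { g with
      map_lie' := fun {c v} => by
        obtain ⟨u, rfl⟩ := (weylIdeal n).mkQ_surjective v
        exact (congrArg g (lie_wmk (r := r) c u)).trans (hg c u) }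
  refine ⟨g', fun p v hv => ?_⟩
  refine weyl_deg_induction (C := fun p => (V.deg p).comap (g' : weyl n r →ₗ[ℂ] V)) ?_
    (fun a s k v hv => ?_) hv
  · change ρ 1 b ∈ V.deg r
    rw [map_one]
    exact hd
  · change g' _ ∈ V.deg _
    rw [LieModuleHom.map_lie]
    exact hV a s k _ hv

lemma weylLift_wgen {V : GrMod} (hV : V.LieDeg) {b : V} (hd : b ∈ V.deg r) (hw : b ∈ V.wt n)
    (hx : ∀ s, ⁅cur slX s, b⁆ = 0) (hy : (V.actY ^ (n + 1)) b = 0) :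
    (weylLift hV hd hw hx hy).toLieHom (wgen n r) = b := by
  change (UniversalEnvelopingAlgebra.lift ℂ (toEnd ℂ Cur V)) 1 b = b
  rw [map_one, Module.End.one_apply]

lemma weyl_hom_ext {V : GrMod} {f g : weyl n r →ₗ⁅ℂ, Cur⁆ V} (h : f (wgen n r) = g (wgen n r))
    (v : weyl n r) : f v = g v :=
  weyl_induction (S := LinearMap.eqLocus (f : weyl n r →ₗ[ℂ] V) (g : weyl n r →ₗ[ℂ] V)) h
    (fun a s v hv => by
      change f _ = g _
      rw [LieModuleHom.map_lie, LieModuleHom.map_lie]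
      exact congrArg _ hv) v

lemma weyl_eq_top_of_wgen_mem {A : LieSubmodule ℂ Cur (weyl n r)} (h : wgen n r ∈ A) : A = ⊤ := by
  rw [eq_top_iff]
  exact fun v _ => weyl_induction (S := A.toSubmodule) h (fun a s v hv => A.lie_mem hv) v

/-! ### Structure of `W(n, r)`: local nilpotency, weights and the lowest degree -/

lemma cur_zero (s : ℕ) : cur 0 s = 0 := map_zero (curLin s)

/-- Every `a ⊗ tˢ` is killed by a power of `ad (y ⊗ 1)`, so the generalized `0`-eigenspace of `y ⊗
1` is a submodule; it contains the generator. -/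
lemma weyl_locNil : (weyl n r).LocNil := by
  have hY : ∀ a s, cur a s ∈ (toEnd ℂ Cur Cur (cur slY 0)).maxGenEigenspace 0 := by
    intro a s
    have hy : cur slY s ∈ (toEnd ℂ Cur Cur (cur slY 0)).maxGenEigenspace 0 := by
      rw [Module.End.mem_maxGenEigenspace]
      refine ⟨1, ?_⟩
      simp [lie_cur, cur_zero]
    have hl : ∀ c, ⁅cur slY 0, c⁆ ∈ (toEnd ℂ Cur Cur (cur slY 0)).maxGenEigenspace 0 →
        c ∈ (toEnd ℂ Cur Cur (cur slY 0)).maxGenEigenspace 0 := by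
      intro c hc
      rw [Module.End.mem_maxGenEigenspace] at hc ⊢
      obtain ⟨k, hk⟩ := hc
      refine ⟨k + 1, ?_⟩
      rw [pow_succ, Module.End.mul_apply]
      simpa using hk
    have hh : cur slH s ∈ (toEnd ℂ Cur Cur (cur slY 0)).maxGenEigenspace 0 := by
      apply hl
      rw [lie_cur, ← lie_skew, lie_slH_slY, zero_add, ← neg_smul, cur_smul]
      exact Submodule.smul_mem _ _ hy
    have hx : cur slX s ∈ (toEnd ℂ Cur Cur (cur slY 0)).maxGenEigenspace 0 := by
      apply hl
      rw [lie_cur, ← lie_skew, lie_slX_slY, zero_add, ← neg_one_smul ℂ, cur_smul]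
      exact Submodule.smul_mem _ _ hh
    rw [sl2_eq a, cur_add, cur_add, cur_smul, cur_smul, cur_smul]
    exact add_mem (add_mem (Submodule.smul_mem _ _ hx) (Submodule.smul_mem _ _ hh))
      (Submodule.smul_mem _ _ hy)
  intro v
  have : v ∈ (weyl n r).actY.maxGenEigenspace 0 := by
    refine weyl_induction ?_ (fun a s v hv => ?_) v
    · rw [Module.End.mem_maxGenEigenspace]
      refine ⟨n + 1, ?_⟩
      rw [zero_smul, sub_zero, actY_pow_wgen]
    · have := lie_mem_maxGenEigenspace_toEnd (hY a s) hv
      rwa [add_zero] at this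
  rw [Module.End.mem_maxGenEigenspace] at this
  obtain ⟨k, hk⟩ := this
  exact ⟨k, by rwa [zero_smul, sub_zero] at hk⟩

/-- Bihomogeneous vectors obtained from highest weight vectors of weight `n` by applying elements
`y ⊗ tˢ`. -/
inductive IsLowered (M : GrMod) (n : ℤ) : ℤ × ℤ → M → Prop
  | base {p : ℤ} {v : M} (hd : v ∈ M.deg p) (hw : v ∈ M.wt n) (hx : ∀ s, ⁅cur slX s, v⁆ = 0) :
    IsLowered M n (p, n) v
  | step {p μ : ℤ} {v : M} (s : ℕ) (hv : IsLowered M n (p, μ) v) :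
    IsLowered M n (s + p, μ - 2) ⁅cur slY s, v⁆

lemma IsLowered.mem_bideg {M : GrMod} (hM : M.LieDeg) {n : ℤ} {q : ℤ × ℤ} {v : M}
    (h : IsLowered M n q v) : q.2 ≤ n ∧ v ∈ M.bideg q := by
  induction h with
  | base hd hw hx => exact ⟨le_rfl, hd, hw⟩
  | step s _ ih => exact ⟨(sub_le_self _ zero_le_two).trans ih.1, hM _ s _ _ ih.2.1,
      curY_mem_wt ih.2.2 s⟩

/-- The span of the vectors obtained by lowering highest weight vectors. -/
def loweredSpan (M : GrMod) (n : ℤ) : Submodule ℂ M := Submodule.span ℂ {v | ∃ q, IsLowered M n q v}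

lemma curY_mem_loweredSpan {M : GrMod} {n : ℤ} {v : M} (hv : v ∈ loweredSpan M n) (s : ℕ) :
    ⁅cur slY s, v⁆ ∈ loweredSpan M n := by
  change v ∈ (loweredSpan M n).comap (toEnd ℂ Cur M (cur slY s))
  refine Submodule.span_le.mpr ?_ hv
  rintro v ⟨⟨p, μ⟩, hv⟩
  exact Submodule.subset_span ⟨_, hv.step s⟩

/-- Applying `h ⊗ tˢ` to a highest weight vector gives another one, which is why `IsLowered.base`
admits all such vectors and not only the generator. -/
lemma curH_mem_loweredSpan {M : GrMod} (hM : M.LieDeg) {n : ℤ} {q : ℤ × ℤ} {v : M}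
    (hv : IsLowered M n q v) (s : ℕ) : ⁅cur slH s, v⁆ ∈ loweredSpan M n := by
  induction hv with
  | @base p v hd hw hx =>
    refine Submodule.subset_span ⟨_, .base (hM _ s _ _ hd) (curH_mem_wt hw s) fun t => ?_⟩
    have := curH_curX s t v
    rw [hx, hx, lie_zero, smul_zero, add_zero] at this
    exact this.symm
  | step t hv ih =>
    rw [curH_curY]
    exact sub_mem (curY_mem_loweredSpan ih t)
      (Submodule.smul_mem _ _ (Submodule.subset_span ⟨_, hv.step _⟩))

lemma curX_mem_loweredSpan {M : GrMod} (hM : M.LieDeg) {n : ℤ} {q : ℤ × ℤ} {v : M}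
    (hv : IsLowered M n q v) (s : ℕ) : ⁅cur slX s, v⁆ ∈ loweredSpan M n := by
  induction hv with
  | base hd hw hx => rw [hx]; exact zero_mem _
  | step t hv ih =>
    rw [curX_curY]
    exact add_mem (curY_mem_loweredSpan ih t) (curH_mem_loweredSpan hM hv _)

/-- The span of lowered vectors contains the generator and is stable under the action, so it is
everything; no basis of `U` is needed. -/
lemma weyl_isBispanned_and_wtLE : (weyl n r).IsBispanned ∧ (weyl n r).WtLE n := by
  apply isBispanned_and_wtLE
  intro v
  have : v ∈ loweredSpan (weyl n r) n := by
    refine weyl_induction (S := loweredSpan (weyl n r) n)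
      (Submodule.subset_span ⟨_, .base wgen_mem_deg wgen_mem_wt curX_wgen⟩)
      (fun a s v hv => ?_) v
    change v ∈ (loweredSpan (weyl n r) n).comap (toEnd ℂ Cur (weyl n r) (cur a s))
    refine Submodule.span_le.mpr ?_ hv
    rintro v ⟨q, hv⟩
    exact cur_lie_mem (curX_mem_loweredSpan weyl_lieDeg hv s)
      (curH_mem_loweredSpan weyl_lieDeg hv s)
      (curY_mem_loweredSpan (Submodule.subset_span ⟨_, hv⟩) s) a
  refine Submodule.span_mono ?_ this
  rintro v ⟨q, hv⟩
  exact ⟨q, hv.mem_bideg weyl_lieDeg⟩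

lemma weyl_deg_eq_bot {p : ℤ} (hp : p < r) : (weyl n r).deg p = ⊥ := by
  rw [Submodule.eq_bot_iff]
  intro v hv
  have := weyl_deg_induction (C := fun p => if p < r then ⊥ else ⊤) (by simp)
    (fun a s k v hv => ?_) hv
  · simpa [hp] using this
  · by_cases hk : k < r
    · rw [if_pos hk, Submodule.mem_bot] at hv
      rw [hv, lie_zero]
      exact zero_mem _
    · rw [if_neg (by lia)]
      trivial

lemma weyl_deg_le_span {v : weyl n r} (hv : v ∈ (weyl n r).deg r) :
    v ∈ Submodule.span ℂ (Set.range fun k => ((weyl n r).actY ^ k) (wgen n r)) := by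
  set Y := Submodule.span ℂ (Set.range fun k => ((weyl n r).actY ^ k) (wgen n r)) with hY
  have hYmem : ∀ k, ((weyl n r).actY ^ k) (wgen n r) ∈ Y := fun k => Submodule.subset_span ⟨k, rfl⟩
  have hstab : ∀ a, ∀ v ∈ Y, ⁅cur a 0, v⁆ ∈ Y := by
    intro a v hv
    change v ∈ Y.comap (toEnd ℂ Cur (weyl n r) (cur a 0))
    refine Submodule.span_le.mpr ?_ hv
    rintro _ ⟨k, rfl⟩
    refine cur_lie_mem (S := Y) ?_ ?_ ?_ a
    · cases k with
      | zero =>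
        change ⁅_, wgen n r⁆ ∈ Y
        rw [curX_wgen]
        exact zero_mem _
      | succ k =>
        rw [curX_actY_pow wgen_mem_wt (curX_wgen 0)]
        exact Submodule.smul_mem _ _ (hYmem k)
    · rw [mem_wt.mp (actY_pow_mem_wt wgen_mem_wt k)]
      exact Submodule.smul_mem _ _ (hYmem k)
    · rw [← actY_pow_succ]
      exact hYmem _
  -- Only the operators `a ⊗ 1` can stay in degree `r`, so it is enough that `Y` is stable under
  -- these; nothing is claimed in higher degrees.
  have := weyl_deg_induction (C := fun p => if p < r then ⊥ else if p = r then Y else ⊤)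
    (by simpa using hYmem 0) (fun a s k v hv => ?_) hv
  · simpa using this
  · rcases lt_trichotomy k r with hk | rfl | hk
    · rw [if_pos hk, Submodule.mem_bot] at hv
      rw [hv, lie_zero]
      exact zero_mem _
    · rw [if_neg (lt_irrefl _), if_pos rfl] at hv
      rw [if_neg (by lia)]
      split_ifs with hs
      · obtain rfl : s = 0 := by lia
        exact hstab a v hv
      · trivial
    · rw [if_neg (by lia), if_neg (by lia)]
      trivial

/-- Degree `r` is spanned by the `yᵏ wₙ`, of weight `n - 2k`, and only `k = 0` has weight `n`. -/
lemma weyl_eq_smul_wgen {v : weyl n r} (hv : v ∈ (weyl n r).bideg (r, n)) :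
    ∃ c : ℂ, v = c • wgen n r := by
  obtain ⟨a, ha, hav⟩ := exists_mem_map_eq_of_iSupIndep (LinearMap.id : weyl n r →ₗ[ℂ] weyl n r)
    (A := fun μ : ℤ => if μ = n then Submodule.span ℂ {wgen n r} else (weyl n r).wt μ)
    (weyl n r).iSupIndep_wt (fun i a ha => by
      split_ifs at ha with h
      · subst h
        exact (Submodule.span_singleton_le_iff_mem _ _).mpr wgen_mem_wt ha
      · exact ha) (v := v) (i := (n : ℤ)) (by
      refine Submodule.span_le.mpr ?_ (weyl_deg_le_span hv.1)
      rintro _ ⟨k, rfl⟩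
      refine Submodule.mem_iSup_of_mem ((n : ℤ) - 2 * k) ?_
      cases k with
      | zero =>
        rw [if_pos (by simp)]
        exact Submodule.mem_span_singleton_self _
      | succ k =>
        rw [if_neg (by push_cast; lia)]
        exact actY_pow_mem_wt wgen_mem_wt _) hv.2
  rw [if_pos rfl] at ha
  obtain ⟨c, rfl⟩ := Submodule.mem_span_singleton.mp ha
  exact ⟨c, hav.symm⟩

/-! ### Maps out of global Weyl modules and their direct sums -/

namespace GrMod

variable {M : GrMod}

/-- Modules in which every bihomogeneous vector of weight `n` receives a map from `W(n)`. -/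
structure IsHighest (M : GrMod) (n : ℕ) : Prop where
  lieDeg : M.LieDeg
  wtLE : M.WtLE n
  locNil : M.LocNil

/-- The source of projectivity: `x ⊗ tˢ` would send `b` to weight `n + 2`, and local nilpotency
supplies the remaining relation. -/
lemma IsHighest.exists_hom {V : GrMod} (hV : V.IsHighest n) {b : V} (hb : b ∈ V.bideg (r, n)) :
    ∃ f : Hom (weyl n r) V, f.toLieHom (wgen n r) = b := by
  have hx : ∀ s, ⁅cur slX s, b⁆ = 0 := fun s => by
    have := curX_mem_wt hb.2 s
    rwa [hV.wtLE _ (by lia), Submodule.mem_bot] at this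
  exact ⟨weylLift hV.lieDeg hb.1 hb.2 hx (hV.locNil.actY_pow_eq_zero hb.2 (hx 0)),
    weylLift_wgen _ _ _ _ _⟩

lemma IsBdd.isHighest (hM : M.IsBdd) (h : M.WtLE n) : M.IsHighest n :=
  ⟨hM.lie_mem, h, hM.locNil⟩

/-- The direct sum of the `W(n, pⱼ)`. -/
abbrev weylSum (n : ℕ) {J : Type*} (p : J → ℤ) : GrMod := directSum fun j => weyl n (p j)

variable {J : Type*} {p : J → ℤ}

lemma weylSum_isHighest : (weylSum n p).IsHighest n :=
  ⟨LieDeg.directSum fun _ => weyl_lieDeg, WtLE.directSum fun _ => weyl_isBispanned_and_wtLE.2,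
    LocNil.directSum fun _ => weyl_locNil⟩

lemma weylSum_isBispanned : (weylSum n p).IsBispanned :=
  IsBispanned.directSum fun _ => weyl_isBispanned_and_wtLE.1

/-- The generators of a direct sum of global Weyl modules. -/
def sumGen (n : ℕ) (p : J → ℤ) (j : J) : weylSum n p :=
  (ofHom (fun j => weyl n (p j)) j).toLieHom (wgen n (p j))

lemma sumGen_mem_bideg (j : J) : sumGen n p j ∈ (weylSum n p).bideg (p j, n) :=
  map_mem_bideg _ ⟨wgen_mem_deg, wgen_mem_wt⟩

lemma IsHighest.exists_sum_hom {V : GrMod} (hV : V.IsHighest n) (b : J → V)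
    (hb : ∀ j, b j ∈ V.bideg (p j, n)) :
    ∃ f : Hom (weylSum n p) V, ∀ j, f.toLieHom (sumGen n p j) = b j := by
  choose f hf using fun j => hV.exists_hom (hb j)
  exact ⟨descHom f, fun j => (descHom_ofHom _ _ _).trans (hf j)⟩

lemma weylSum_hom_ext {V : GrMod} {f g : weylSum n p →ₗ⁅ℂ, Cur⁆ V}
    (h : ∀ j, f (sumGen n p j) = g (sumGen n p j)) (v : weylSum n p) : f v = g v := by
  refine directSum_hom_ext (fun j v => ?_) v
  exact weyl_hom_ext (f := f.comp (ofHom (fun j => weyl n (p j)) j).toLieHom)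
    (g := g.comp (ofHom (fun j => weyl n (p j)) j).toLieHom) (h j) v

lemma weylSum_eq_top {A : LieSubmodule ℂ Cur (weylSum n p)} (h : ∀ j, sumGen n p j ∈ A) :
    A = ⊤ := by
  rw [eq_top_iff]
  rintro v -
  refine directSum_induction v (zero_mem _) (fun j v => ?_) fun v w hv hw => add_mem hv hw
  have : A.comap (ofHom (fun j => weyl n (p j)) j).toLieHom = ⊤ := weyl_eq_top_of_wgen_mem (h j)
  exact (this ▸ LieSubmodule.mem_top v :
    v ∈ A.comap (ofHom (fun j => weyl n (p j)) j).toLieHom)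

end GrMod

end CurrentSl2

end

noncomputable section

namespace CurrentSl2

open GrMod

/-! ### Direct summands of direct sums of global Weyl modules -/

/-- `M` is isomorphic to a direct sum of copies of `W(n, p)`, `p ∈ ℤ`, with finite multiplicities. -/
def IsFree (n : ℕ) (M : GrMod) : Prop :=
  ∃ (m : ℤ → ℕ) (e : M ≃ₗ⁅ℂ, Cur⁆ (GrMod.directSum fun q : (p : ℤ) × Fin (m p) => weyl n q.1)),
    ∀ p v, v ∈ M.deg p ↔
      e v ∈ (GrMod.directSum fun q : (p : ℤ) × Fin (m p) => weyl n q.1).deg p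

/-- `M` is a direct summand of `N`. -/
def IsRetract (M N : GrMod) : Prop :=
  ∃ (i : GrMod.Hom M N) (π : GrMod.Hom N M), ∀ v, π.toLieHom (i.toLieHom v) = v

lemma IsRetract.trans {M N P : GrMod} (h : IsRetract M N) (h' : IsRetract N P) :
    IsRetract M P := by
  obtain ⟨i, π, h⟩ := h
  obtain ⟨i', π', h'⟩ := h'
  exact ⟨i.then i', π'.then π, fun v => by simp [h, h']⟩

/-- An isomorphism of Lie modules from mutually inverse maps. -/
def lieEquivOfInverse {M N : GrMod} (f : GrMod.Hom M N) (g : GrMod.Hom N M)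
    (hgf : ∀ v, g.toLieHom (f.toLieHom v) = v) (hfg : ∀ v, f.toLieHom (g.toLieHom v) = v) :
    M ≃ₗ⁅ℂ, Cur⁆ N where
  __ := f.toLieHom
  invFun := g.toLieHom
  left_inv := hgf
  right_inv := hfg

lemma isFree_of_inverse {n : ℕ} {M : GrMod} {m : ℤ → ℕ}
    (f : GrMod.Hom M (weylSum n fun q : (p : ℤ) × Fin (m p) => q.1))
    (g : GrMod.Hom (weylSum n fun q : (p : ℤ) × Fin (m p) => q.1) M)
    (hgf : ∀ v, g.toLieHom (f.toLieHom v) = v) (hfg : ∀ v, f.toLieHom (g.toLieHom v) = v) :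
    IsFree n M :=
  ⟨m, lieEquivOfInverse f g hgf hfg, fun p v => ⟨f.map_deg p v, fun h => by
    rw [← hgf v]; exact g.map_deg p _ h⟩⟩

lemma IsFree.exists_inverse {n : ℕ} {M : GrMod} (h : IsFree n M) : ∃ (m : ℤ → ℕ)
    (f : GrMod.Hom M (weylSum n fun q : (p : ℤ) × Fin (m p) => q.1))
    (g : GrMod.Hom (weylSum n fun q : (p : ℤ) × Fin (m p) => q.1) M),
    (∀ v, g.toLieHom (f.toLieHom v) = v) ∧ (∀ v, f.toLieHom (g.toLieHom v) = v) := by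
  obtain ⟨m, e, he⟩ := h
  refine ⟨m, ⟨e.toLieModuleHom, fun p v hv => (he p v).mp hv⟩, ⟨e.symm.toLieModuleHom,
    fun p v hv => (he p _).mpr ?_⟩, fun v => e.symm_apply_apply v, fun v => e.apply_symm_apply v⟩
  exact (e.apply_symm_apply v).symm ▸ hv

/-- Lifts of a basis of the image of `B` in `V / D`. -/
lemma exists_basis_modulo {K V : Type*} [Field K] [AddCommGroup V] [Module K V]
    (B D : Submodule K V) [FiniteDimensional K B] : ∃ (m : ℕ) (v : Fin m → V), (∀ j, v j ∈ B) ∧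
      (∀ b ∈ B, ∃ c : Fin m → K, b - ∑ j, c j • v j ∈ D) ∧
      ∀ c : Fin m → K, ∑ j, c j • v j ∈ D → c = 0 := by
  let b := Module.finBasis K (B.map D.mkQ)
  choose v hv hvb using fun j => (b j).2
  refine ⟨_, v, hv, fun x hx => ?_, fun c hc => ?_⟩
  · refine ⟨b.repr ⟨D.mkQ x, Submodule.mem_map_of_mem hx⟩, ?_⟩
    refine (Submodule.Quotient.mk_eq_zero D).mp ?_
    rw [← Submodule.mkQ_apply, map_sub, map_sum, sub_eq_zero]
    have := congrArg (B.map D.mkQ).subtype (b.sum_repr ⟨D.mkQ x, Submodule.mem_map_of_mem hx⟩)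
    rw [map_sum] at this
    simp only [map_smul, Submodule.subtype_apply] at this
    refine this.symm.trans ?_
    simp only [map_smul, hvb]
  · have h := Fintype.linearIndependent_iff.mp b.linearIndependent c (Subtype.ext ?_)
    · exact funext h
    · replace hc := (Submodule.Quotient.mk_eq_zero D).mpr hc
      rw [← Submodule.mkQ_apply, map_sum] at hc
      simpa [hvb] using hc

lemma mem_of_ofHom_proj_mem {ι : Type*} {N : ι → GrMod} {A : Submodule ℂ (GrMod.directSum N)}
    {v : GrMod.directSum N}
    (h : ∀ i, (ofHom N i).toLieHom ((projHom N i).toLieHom v) ∈ A) : v ∈ A := by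
  classical
  have : v = ∑ i ∈ DFinsupp.support (show DirectSum ι fun i => (N i).carrier from v),
      DirectSum.of (fun i => (N i).carrier) i
        ((show DirectSum ι fun i => (N i).carrier from v) i) :=
    (DirectSum.sum_support_of _).symm
  rw [this]
  refine sum_mem fun i _ => ?_
  exact h i

variable {n : ℕ}

lemma ofHom_mem_of_sumGen_mem {J : Type*} {p : J → ℤ} {A : LieSubmodule ℂ Cur (weylSum n p)}
    {j : J} (h : sumGen n p j ∈ A) (v : weyl n (p j)) :
    (ofHom (fun j => weyl n (p j)) j).toLieHom v ∈ A := by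
  have : A.comap (ofHom (fun j => weyl n (p j)) j).toLieHom = ⊤ := weyl_eq_top_of_wgen_mem h
  exact (this ▸ LieSubmodule.mem_top v :
    v ∈ A.comap (ofHom (fun j => weyl n (p j)) j).toLieHom)

/-- A bihomogeneous vector of weight `n` in a direct sum of global Weyl modules is a combination of
the generators in its degree, modulo the submodule generated in smaller degrees. -/
lemma exists_sub_sum_mem {m : ℤ → ℕ} {p : ℤ}
    {z : weylSum n fun q : (p : ℤ) × Fin (m p) => q.1}
    (hz : z ∈ (weylSum n fun q : (p : ℤ) × Fin (m p) => q.1).bideg (p, n))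
    {A : LieSubmodule ℂ Cur (weylSum n fun q : (p : ℤ) × Fin (m p) => q.1)}
    (hA : ∀ q : (p : ℤ) × Fin (m p), q.1 < p →
      sumGen n (fun q : (p : ℤ) × Fin (m p) => q.1) q ∈ A) :
    ∃ c : Fin (m p) → ℂ,
      z - ∑ j, c j • sumGen n (fun q : (p : ℤ) × Fin (m p) => q.1) ⟨p, j⟩ ∈ A := by
  have hproj : ∀ q : (p : ℤ) × Fin (m p),
      (projHom (fun q : (p : ℤ) × Fin (m p) => weyl n q.1) q).toLieHom z ∈
        (weyl n q.1).bideg (p, n) :=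
    fun q => map_mem_bideg (projHom (fun q : (p : ℤ) × Fin (m p) => weyl n q.1) q) hz
  choose c hc using fun j : Fin (m p) => weyl_eq_smul_wgen (hproj ⟨p, j⟩)
  refine ⟨c, mem_of_ofHom_proj_mem (A := A.toSubmodule) fun q => ?_⟩
  have hne : ∀ q : (p : ℤ) × Fin (m p), q.1 ≠ p →
      (projHom (fun q : (p : ℤ) × Fin (m p) => weyl n q.1) q).toLieHom
        (∑ j, c j • sumGen n (fun q : (p : ℤ) × Fin (m p) => q.1) ⟨p, j⟩) = 0 := fun q hq => by
    rw [map_sum]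
    refine Finset.sum_eq_zero fun j _ => ?_
    rw [map_smul, sumGen]
    rw [projHom_ofHom_ne (N := fun q : (p : ℤ) × Fin (m p) => weyl n q.1)
      (fun h => hq (congrArg Sigma.fst h).symm), smul_zero]
  -- Summands starting below degree `p` lie in `A`; those starting in degree `p` contribute a
  -- multiple of the generator, already subtracted; those starting above `p` have no part of degree
  -- `p`.
  rcases lt_trichotomy q.1 p with hq | hq | hq
  · exact ofHom_mem_of_sumGen_mem (hA q hq) _
  · obtain ⟨p', j⟩ := q
    dsimp only at hq
    subst hq
    rw [map_sub, hc, map_sum, Finset.sum_eq_single j, map_smul, sumGen, projHom_ofHom_same, sub_self,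
      map_zero]
    · exact zero_mem _
    · intro j' _ hj
      rw [map_smul, sumGen]
      rw [projHom_ofHom_ne (N := fun q : (p : ℤ) × Fin (m p) => weyl n q.1)
        (fun h => hj (by simpa using h)), smul_zero]
    · exact fun h => absurd (Finset.mem_univ j) h
  · have h0 : (projHom (fun q : (p : ℤ) × Fin (m p) => weyl n q.1) q).toLieHom z ∈
        (weyl n q.1).deg p := (hproj q).1
    rw [weyl_deg_eq_bot hq, Submodule.mem_bot] at h0
    rw [map_sub, h0, hne q hq.ne', sub_zero, map_zero]
    exact zero_mem _

lemma int_strong_induction {C : ℤ → Prop} (p₀ : ℤ) (h0 : ∀ p < p₀, C p)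
    (h : ∀ p, (∀ q < p, C q) → C p) (p : ℤ) : C p := by
  have : ∀ k : ℕ, ∀ p < p₀ + k, C p := by
    intro k
    induction k with
    | zero => simpa using h0
    | succ k ih => exact fun p hp => h p fun q hq => ih q (by push_cast at hp; lia)
  exact this (p - p₀ + 1).toNat p (by lia)

/-- The source is generated by its vectors of weight `n`, hence so is its image. -/
lemma top_eq_top_of_surjective {J : Type*} {p : J → ℤ} {V : GrMod} (π : GrMod.Hom (weylSum n p) V)
    (hπ : Function.Surjective π.toLieHom) : V.top n = ⊤ := by
  have : (V.top n).comap π.toLieHom = ⊤ :=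
    weylSum_eq_top fun j => wt_le_top (map_mem_wt π.toLieHom (sumGen_mem_bideg j).2)
  rw [eq_top_iff]
  intro v _
  obtain ⟨w, rfl⟩ := hπ v
  exact (this ▸ LieSubmodule.mem_top w : w ∈ (V.top n).comap π.toLieHom)

/-- A direct summand of a direct sum of global Weyl modules `W(n, p)` is a direct sum of such
modules. -/
theorem isFree_of_isRetract {J : Type*} {p : J → ℤ} {V : GrMod} (hV : V.IsBdd)
    (h : IsRetract V (weylSum n p)) : IsFree n V := by
  obtain ⟨i, π, hπ⟩ := h
  have hwt : V.WtLE n := fun μ hμ => by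
    rw [Submodule.eq_bot_iff]
    intro v hv
    have := map_mem_wt i.toLieHom hv
    rw [weylSum_isHighest.wtLE μ hμ, Submodule.mem_bot] at this
    rw [← hπ v, this, map_zero]
  have hV' := hV.isHighest hwt
  obtain ⟨p₀, hp₀⟩ := hV.deg_eq_bot
  -- `L p` is generated in degrees below `p`, so a basis of `V[p]_n` modulo `L p` gives the new
  -- generators needed in degree `p`.
  let L : ℤ → LieSubmodule ℂ Cur V := fun p =>
    LieSubmodule.lieSpan ℂ Cur {v | ∃ q < p, v ∈ V.bideg (q, n)}
  have hex : ∀ p : ℤ, ∃ (m : ℕ) (v : Fin m → V), (∀ j, v j ∈ V.bideg (p, n)) ∧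
      (∀ b ∈ V.bideg (p, n), ∃ c : Fin m → ℂ, b - ∑ j, c j • v j ∈ (L p).toSubmodule) ∧
      ∀ c : Fin m → ℂ, ∑ j, c j • v j ∈ (L p).toSubmodule → c = 0 := fun p => by
    have := hV.finiteDimensional p
    have : FiniteDimensional ℂ (V.bideg (p, n)) :=
      Submodule.finiteDimensional_of_le (inf_le_left : V.bideg (p, n) ≤ V.deg p)
    exact exists_basis_modulo _ _
  choose m v hv hspan hindep using hex
  let F := weylSum n fun q : (p : ℤ) × Fin (m p) => q.1
  obtain ⟨φ, hφ⟩ := hV'.exists_sum_hom (p := fun q : (p : ℤ) × Fin (m p) => q.1)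
    (fun q => v q.1 q.2) fun q => hv q.1 q.2
  have hrange : ∀ p, ∀ b ∈ V.bideg (p, n), b ∈ φ.toLieHom.range := by
    intro p
    induction p using int_strong_induction p₀ with
    | h0 p hp =>
      intro b hb
      have h0 : b ∈ V.deg p := hb.1
      rw [hp₀ p hp, Submodule.mem_bot] at h0
      rw [h0]
      exact zero_mem _
    | h p ih =>
      intro b hb
      have hL : L p ≤ φ.toLieHom.range := LieSubmodule.lieSpan_le.mpr (by
        rintro b ⟨q, hq, hb⟩
        exact ih q hq b hb)
      obtain ⟨c, hc⟩ := hspan p b hb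
      rw [← sub_add_cancel b (∑ j, c j • v p j)]
      refine add_mem (hL hc) (sum_mem fun j _ => Submodule.smul_mem _ _ ?_)
      exact ⟨sumGen n _ ⟨p, j⟩, hφ ⟨p, j⟩⟩
  have hφs : Function.Surjective φ.toLieHom := by
    rw [← LieModuleHom.range_eq_top, eq_top_iff,
      ← top_eq_top_of_surjective π fun v => ⟨i.toLieHom v, hπ v⟩]
    refine LieSubmodule.lieSpan_le.mpr fun b hb => ?_
    have hle : ⨆ p, V.deg p ⊓ V.wt n ≤ φ.toLieHom.range.toSubmodule :=
      iSup_le fun p b hb => hrange p b hb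
    exact hle (hV.mem_iSup_deg_inf_wt hb)
  -- By projectivity `π` lifts through the surjection `φ` to some `σ`; then `i` followed by `σ` is a
  -- section of `φ`.
  have hlift : ∀ j, ∃ b ∈ F.bideg (p j, n), φ.toLieHom b = π.toLieHom (sumGen n p j) := fun j => by
    obtain ⟨x, hx⟩ := hφs (π.toLieHom (sumGen n p j))
    rw [← hx]
    refine weylSum_isBispanned.exists_bideg hV.iSupIndep_bideg φ ?_
    rw [hx]
    exact map_mem_bideg π (sumGen_mem_bideg j)
  choose b hb hbπ using hlift
  obtain ⟨σ, hσ⟩ := (weylSum_isHighest (n := n)).exists_sum_hom b hb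
  have hφσ : ∀ x, φ.toLieHom (σ.toLieHom x) = π.toLieHom x := fun x =>
    weylSum_hom_ext (f := (σ.then φ).toLieHom) (g := π.toLieHom) (fun j => by
      rw [Hom.then_apply, hσ, hbπ]) x
  have hφs' : ∀ x, φ.toLieHom ((i.then σ).toLieHom x) = x := fun x => by
    rw [Hom.then_apply, hφσ, hπ]
  refine isFree_of_inverse (i.then σ) φ hφs' fun x => ?_
  refine weylSum_hom_ext (f := (φ.then (i.then σ)).toLieHom) (g := LieModuleHom.id) ?_ x
  suffices key : ∀ (p : ℤ) (j : Fin (m p)),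
      (φ.then (i.then σ)).toLieHom (sumGen n _ ⟨p, j⟩) = sumGen n _ ⟨p, j⟩ from
    fun q => key q.1 q.2
  intro p
  induction p using int_strong_induction p₀ with
  | h0 p hp =>
    intro j
    -- Below `p₀` the piece `V[p]` is zero, so any index `j` would give a forbidden nontrivial
    -- relation.
    refine absurd (hindep p (Pi.single j 1) ?_) fun h => ?_
    · refine sum_mem fun k _ => Submodule.smul_mem _ _ ?_
      have h0 : v p k ∈ V.deg p := (hv p k).1
      rw [hp₀ p hp, Submodule.mem_bot] at h0
      rw [h0]
      exact zero_mem _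
    · have := congrFun h j
      simp at this
  | h p ih =>
    intro j
    set ψ := φ.then (i.then σ) with hψ
    set g : F := sumGen n (fun q : (p : ℤ) × Fin (m p) => q.1) ⟨p, j⟩ with hg
    let A : LieSubmodule ℂ Cur F := LieSubmodule.lieSpan ℂ Cur
      {x | ∃ q : (p : ℤ) × Fin (m p), q.1 < p ∧
        x = sumGen n (fun q : (p : ℤ) × Fin (m p) => q.1) q}
    have hz : g - ψ.toLieHom g ∈ F.bideg (p, n) := by
      have := sumGen_mem_bideg (n := n) (p := fun q : (p : ℤ) × Fin (m p) => q.1) ⟨p, j⟩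
      exact sub_mem this (map_mem_bideg ψ this)
    have hφz : φ.toLieHom (g - ψ.toLieHom g) = 0 := by
      rw [map_sub, hψ, Hom.then_apply, hφs', sub_self]
    obtain ⟨c, hc⟩ := exists_sub_sum_mem hz (A := A)
      fun q hq => LieSubmodule.subset_lieSpan ⟨q, hq, rfl⟩
    have hAL : A ≤ (L p).comap φ.toLieHom := LieSubmodule.lieSpan_le.mpr (by
      rintro _ ⟨q, hq, rfl⟩
      change φ.toLieHom _ ∈ L p
      rw [hφ]
      exact LieSubmodule.subset_lieSpan ⟨q.1, hq, hv q.1 q.2⟩)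
    -- Applying `φ`, which kills `g - ψ g`, puts `∑ cⱼ vⱼ` in `L p`, against minimality of the
    -- generators unless `c = 0`.
    have hc0 : c = 0 := by
      refine hindep p c ?_
      have : φ.toLieHom _ ∈ L p := hAL hc
      rw [map_sub, hφz, zero_sub, map_sum] at this
      simp only [map_smul, hφ] at this
      exact neg_mem_iff.mp this
    rw [hc0] at hc
    simp only [Pi.zero_apply, zero_smul, Finset.sum_const_zero, sub_zero] at hc
    have hAψ : A ≤ (ψ.toLieHom - LieModuleHom.id).ker := LieSubmodule.lieSpan_le.mpr (by
      rintro _ ⟨q, hq, rfl⟩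
      change _ ∈ LieModuleHom.ker _
      rw [LieModuleHom.mem_ker, LieModuleHom.sub_apply, sub_eq_zero]
      exact ih q.1 hq q.2)
    -- Now `g - ψ g` lies in `A`, where `ψ` is the identity by induction; but `ψ` also kills it, as
    -- it factors through `φ`.
    have hfin := hAψ hc
    rw [LieModuleHom.mem_ker, LieModuleHom.sub_apply, sub_eq_zero] at hfin
    have h0 : ψ.toLieHom (g - ψ.toLieHom g) = 0 := by
      nth_rw 1 [hψ]
      rw [Hom.then_apply, hφz, map_zero]
    rw [h0] at hfin
    exact (sub_eq_zero.mp hfin.symm).symm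

end CurrentSl2

end

noncomputable section

namespace CurrentSl2

open GrMod

/-! ### Constructions with degree zero maps -/

namespace GrMod

variable {M N P Q : GrMod}

/-- The identity. -/
def Hom.idHom (M : GrMod) : Hom M M := ⟨LieModuleHom.id, fun _ _ hv => hv⟩

/-- The zero map. -/
def Hom.zeroHom (M N : GrMod) : Hom M N := ⟨0, fun _ _ _ => zero_mem _⟩

/-- The sum of two degree zero maps. -/
def Hom.add (f g : Hom M N) : Hom M N :=
  ⟨f.toLieHom + g.toLieHom, fun p v hv => add_mem (f.map_deg p v hv) (g.map_deg p v hv)⟩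

@[simp] lemma Hom.add_apply (f g : Hom M N) (v : M) :
    (f.add g).toLieHom v = f.toLieHom v + g.toLieHom v := rfl

/-- The difference of two degree zero maps. -/
def Hom.sub (f g : Hom M N) : Hom M N :=
  ⟨f.toLieHom - g.toLieHom, fun p v hv => sub_mem (f.map_deg p v hv) (g.map_deg p v hv)⟩

@[simp] lemma Hom.sub_apply (f g : Hom M N) (v : M) :
    (f.sub g).toLieHom v = f.toLieHom v - g.toLieHom v := rfl

/-- An injective degree zero map which reflects degrees. -/
structure Hom.IsEmbedding (j : Hom N P) : Prop where
  injective : Function.Injective j.toLieHom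
  deg_of_map : ∀ p v, j.toLieHom v ∈ P.deg p → v ∈ N.deg p

lemma Hom.IsEmbedding.exists_lift {j : Hom N P} (hj : j.IsEmbedding) (f : Hom M P)
    (h : ∀ v, ∃ w, j.toLieHom w = f.toLieHom v) :
    ∃ g : Hom M N, ∀ v, j.toLieHom (g.toLieHom v) = f.toLieHom v := by
  choose g hg using h
  refine ⟨⟨{ toFun := g
             map_add' := fun v w => hj.injective (by rw [map_add, hg, hg, hg, map_add])
             map_smul' := fun c v => hj.injective (by
               rw [RingHom.id_apply, map_smul, hg, hg, map_smul])
             map_lie' := fun {c v} => hj.injective ?_ },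
    fun p v hv => hj.deg_of_map p _ ?_⟩, hg⟩
  · rw [LieModuleHom.map_lie, hg, hg, LieModuleHom.map_lie]
  · change j.toLieHom (g v) ∈ P.deg p
    rw [hg]
    exact f.map_deg p v hv

/-- A homogeneous image has a homogeneous preimage, which by injectivity is the given vector. -/
lemma Hom.isEmbedding_of_bispanned (j : Hom N P) (hN : N.IsBispanned) (hP : P.IsGraded)
    (hj : Function.Injective j.toLieHom) : j.IsEmbedding :=
  ⟨hj, fun p v hv => by
    obtain ⟨a, ha, hav⟩ := hN.exists_deg hP j hv
    rwa [← hj hav]⟩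

lemma inclHom_isEmbedding (A : LieSubmodule ℂ Cur M) : (inclHom A).IsEmbedding :=
  ⟨inclHom_injective A, fun _ _ hv => hv⟩

lemma Hom.IsEmbedding.then {f : Hom M N} {g : Hom N P} (hf : f.IsEmbedding) (hg : g.IsEmbedding) :
    (f.then g).IsEmbedding :=
  ⟨fun _ _ h => hf.injective (hg.injective h),
    fun p v hv => hf.deg_of_map p v (hg.deg_of_map p _ hv)⟩

lemma Hom.isEmbedding_of_leftInverse (f : Hom M N) (g : Hom N M)
    (h : ∀ v, g.toLieHom (f.toLieHom v) = v) : f.IsEmbedding :=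
  ⟨Function.LeftInverse.injective h, fun p v hv => by
    rw [← h v]
    exact g.map_deg p _ hv⟩

lemma Hom.IsEmbedding.isRetract {j : Hom N P} (hj : j.IsEmbedding)
    (hs : Function.Surjective j.toLieHom) : IsRetract P N ∧ IsRetract N P := by
  obtain ⟨g, hg⟩ := hj.exists_lift (Hom.idHom P) hs
  exact ⟨⟨g, j, hg⟩, ⟨j, g, fun v => hj.injective (hg _)⟩⟩

section DirectSum

variable {ι : Type*} {N N' : ι → GrMod}

/-- The map of direct sums induced by a family of maps. -/
def sumMap (f : ∀ i, Hom (N i) (N' i)) : Hom (directSum N) (directSum N') :=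
  descHom fun i => (f i).then (ofHom N' i)

lemma sumMap_ofHom (f : ∀ i, Hom (N i) (N' i)) (i : ι) (v : N i) :
    (sumMap f).toLieHom ((ofHom N i).toLieHom v) = (ofHom N' i).toLieHom ((f i).toLieHom v) :=
  descHom_ofHom _ _ _

lemma projHom_sumMap (f : ∀ i, Hom (N i) (N' i)) (i : ι) (v : directSum N) :
    (projHom N' i).toLieHom ((sumMap f).toLieHom v) =
      (f i).toLieHom ((projHom N i).toLieHom v) := by
  refine directSum_hom_ext (f := ((sumMap f).then (projHom N' i)).toLieHom)
    (g := ((projHom N i).then (f i)).toLieHom) (fun j v => ?_) v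
  rw [Hom.then_apply, Hom.then_apply, sumMap_ofHom]
  by_cases h : j = i
  · subst h
    rw [projHom_ofHom_same, projHom_ofHom_same]
  · rw [projHom_ofHom_ne h, projHom_ofHom_ne h, map_zero]

lemma sumMap_isEmbedding {f : ∀ i, Hom (N i) (N' i)} (hf : ∀ i, (f i).IsEmbedding) :
    (sumMap f).IsEmbedding where
  injective v w h := directSum_ext fun i => (hf i).injective (by
    rw [← projHom_sumMap, ← projHom_sumMap, h])
  deg_of_map p v hv i := by
    refine (hf i).deg_of_map p _ ?_
    change (f i).toLieHom ((projHom N i).toLieHom v) ∈ _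
    rw [← projHom_sumMap]
    exact hv i

lemma exists_sumMap_eq {f : ∀ i, Hom (N i) (N' i)} {v : directSum N'}
    (h : ∀ i, ∃ w, (f i).toLieHom w = (projHom N' i).toLieHom v) :
    ∃ w, (sumMap f).toLieHom w = v := by
  change v ∈ (sumMap f).toLieHom.range.toSubmodule
  refine mem_of_ofHom_proj_mem fun i => ?_
  obtain ⟨w, hw⟩ := h i
  exact ⟨(ofHom N i).toLieHom w, by
    rw [← hw]
    exact sumMap_ofHom f i w⟩

end DirectSum

end GrMod

lemma IsRetract.refl (M : GrMod) : IsRetract M M := ⟨Hom.idHom M, Hom.idHom M, fun _ => rfl⟩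

/-- The two sides are isomorphic, but one composite suffices for passing to retracts. -/
lemma isRetract_weylSum_sigma {n : ℕ} {ι : Type*} {κ : ι → Type*} (p : ∀ i, κ i → ℤ) :
    IsRetract (GrMod.directSum fun i => weylSum n (p i))
      (weylSum n fun q : (i : ι) × κ i => p q.1 q.2) := by
  let F : Hom (GrMod.directSum fun i => weylSum n (p i))
      (weylSum n fun q : (i : ι) × κ i => p q.1 q.2) :=
    descHom fun i => descHom fun k => ofHom (fun q : (i : ι) × κ i => weyl n (p q.1 q.2)) ⟨i, k⟩
  let G : Hom (weylSum n fun q : (i : ι) × κ i => p q.1 q.2)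
      (GrMod.directSum fun i => weylSum n (p i)) :=
    descHom fun q => (ofHom (fun k => weyl n (p q.1 k)) q.2).then
      (ofHom (fun i => weylSum n (p i)) q.1)
  refine ⟨F, G, fun v => ?_⟩
  refine directSum_hom_ext (f := (F.then G).toLieHom) (g := LieModuleHom.id) (fun i v => ?_) v
  refine directSum_hom_ext (f := ((ofHom (fun i => weylSum n (p i)) i).then (F.then G)).toLieHom)
    (g := (ofHom (fun i => weylSum n (p i)) i).toLieHom) (fun k v => ?_) v
  rw [Hom.then_apply, Hom.then_apply, descHom_ofHom, descHom_ofHom, descHom_ofHom]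
  rfl

/-! ### Layered modules -/

/-- The weights of `M` are less than `n`, and the quotients of its canonical filtration by
submodules generated by weight spaces are direct sums of global Weyl modules. -/
def Layered : ℕ → GrMod → Prop
  | 0, M => Subsingleton M
  | n + 1, M => IsFree n (M.sub (M.top n)) ∧ Layered n (M.quot (M.top n))

lemma isFree_of_subsingleton {n : ℕ} {M : GrMod} (h : Subsingleton M) : IsFree n M := by
  have : Subsingleton (weylSum n fun q : (_ : ℤ) × Fin 0 => q.1) :=
    directSum_subsingleton fun q => q.2.elim0
  exact isFree_of_inverse (m := fun _ => 0) (Hom.zeroHom _ _) (Hom.zeroHom _ _)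
    (fun _ => Subsingleton.elim _ _) fun _ => Subsingleton.elim _ _

lemma subsingleton_quot {M : GrMod} (h : Subsingleton M) (A : LieSubmodule ℂ Cur M) :
    Subsingleton (M.quot A) := (mkHom_surjective A).subsingleton

lemma layered_of_subsingleton (n : ℕ) {M : GrMod} (h : Subsingleton M) : Layered n M := by
  induction n generalizing M with
  | zero => exact h
  | succ n ih =>
    exact ⟨isFree_of_subsingleton ⟨fun _ _ => Subtype.ext (h.elim _ _)⟩, ih (subsingleton_quot h _)⟩

/-- Being layered passes to direct summands of direct sums. -/
theorem layered_of_isRetract {ι : Type*} (n : ℕ) {N : ι → GrMod} {D : GrMod} (hD : D.IsBdd)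
    (h : IsRetract D (GrMod.directSum N)) (hN : ∀ i, Layered n (N i)) : Layered n D := by
  induction n generalizing N D with
  | zero =>
    obtain ⟨i, π, hπ⟩ := h
    have := directSum_subsingleton hN
    exact (Function.LeftInverse.injective hπ).subsingleton
  | succ n ih =>
    obtain ⟨i, π, hπ⟩ := h
    constructor
    -- The map `D.top n → ⨁ N k` has components in the `(N k).top n`, so it factors through their
    -- sum, a direct sum of global Weyl modules. That sum may have infinite multiplicities;
    -- boundedness of `D` makes those of `D.top n` finite.
    · choose m f g hgf hfg using fun k => (hN k).1.exists_inverse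
      let c : ∀ k, Hom (weylSum n fun q : (p : ℤ) × Fin (m k p) => q.1) (N k) := fun k =>
        (g k).then (inclHom ((N k).top n))
      have hc : ∀ k, (c k).IsEmbedding := fun k =>
        (Hom.isEmbedding_of_leftInverse _ _ (hfg k)).then (inclHom_isEmbedding _)
      obtain ⟨j, hj⟩ := (sumMap_isEmbedding hc).exists_lift ((inclHom (D.top n)).then i)
        fun v => exists_sumMap_eq fun k => by
          let x : (N k).sub ((N k).top n) :=
            ⟨_, map_mem_top ((i.then (projHom N k)).toLieHom) v.2⟩
          exact ⟨(f k).toLieHom x, congrArg Subtype.val (hgf k x)⟩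
      refine isFree_of_isRetract (hD.sub (hD.top n)) (IsRetract.trans ⟨j,
        ((sumMap c).then π).toSub (D.top n) fun v => ?_, fun v => Subtype.ext ?_⟩
        (isRetract_weylSum_sigma fun k (q : (p : ℤ) × Fin (m k p)) => q.1))
      · refine map_mem_top π.toLieHom ?_
        have : ((GrMod.directSum N).top n).comap (sumMap c).toLieHom = ⊤ := by
          rw [eq_top_iff]
          rintro v -
          refine directSum_induction (C := fun v =>
            v ∈ ((GrMod.directSum N).top n).comap (sumMap c).toLieHom) v (zero_mem _)
            (fun k v => ?_) fun v w hv hw => add_mem hv hw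
          rw [LieSubmodule.mem_comap, sumMap_ofHom]
          exact map_mem_top _ ((g k).toLieHom v).2
        exact (this ▸ LieSubmodule.mem_top v :
          v ∈ ((GrMod.directSum N).top n).comap (sumMap c).toLieHom)
      · exact (congrArg π.toLieHom (hj v)).trans (hπ _)
    -- Both maps of the retraction respect `top n`, so they descend to the quotients.
    · let q : Hom (GrMod.directSum N) (GrMod.directSum fun k => (N k).quot ((N k).top n)) :=
        sumMap fun k => mkHom ((N k).top n)
      have hq : ∀ v ∈ D.top n, (i.then q).toLieHom v = 0 := fun v hv => directSum_ext fun k => by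
        rw [Hom.then_apply, projHom_sumMap, map_zero, mkHom_eq_zero]
        exact map_mem_top (projHom N k).toLieHom (map_mem_top i.toLieHom hv)
      let π' : Hom (GrMod.directSum fun k => (N k).quot ((N k).top n)) (D.quot (D.top n)) :=
        descHom fun k => (((ofHom N k).then π).then (mkHom _)).ofQuot _ fun v hv => by
          rw [Hom.then_apply, mkHom_eq_zero]
          exact map_mem_top _ hv
      have hπ' : ∀ x, π'.toLieHom (q.toLieHom x) = (mkHom _).toLieHom (π.toLieHom x) := fun x => by
        refine directSum_hom_ext (f := (q.then π').toLieHom) (g := (π.then (mkHom _)).toLieHom)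
          (fun k v => ?_) x
        rw [Hom.then_apply, sumMap_ofHom, descHom_ofHom, Hom.ofQuot_mk]
        rfl
      refine ih (hD.quot (hD.top n)) ⟨(i.then q).ofQuot _ hq, π', fun v => ?_⟩ fun k => (hN k).2
      obtain ⟨v, rfl⟩ := mkHom_surjective _ v
      rw [Hom.ofQuot_mk, Hom.then_apply, hπ', hπ]

end CurrentSl2

end

noncomputable section

namespace CurrentSl2

open GrMod

/-! ### Bounds on weights -/

namespace GrMod

variable {M N : GrMod}

lemma WtLE.of_injective {n : ℤ} (h : N.WtLE n) (f : Hom M N)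
    (hf : Function.Injective f.toLieHom) : M.WtLE n := fun μ hμ => by
  rw [Submodule.eq_bot_iff]
  intro v hv
  have := map_mem_wt f.toLieHom hv
  rw [h μ hμ, Submodule.mem_bot] at this
  exact hf (this.trans (map_zero _).symm)

lemma WtLE.of_surjective {n : ℤ} (h : M.WtLE n) (hM : M.IsBispanned) (f : Hom M N)
    (hf : Function.Surjective f.toLieHom) : N.WtLE n := fun μ hμ => by
  rw [Submodule.eq_bot_iff]
  intro v hv
  obtain ⟨v, rfl⟩ := hf v
  obtain ⟨m, hm, hmv⟩ := hM.exists_wt f.toLieHom hv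
  rw [h μ hμ, Submodule.mem_bot] at hm
  rw [← hmv, hm, map_zero]

/-- A vector of weight `n` in the quotient lifts to one in `M`, which lies in `M.top n`. -/
lemma WtLE.quot_top {n : ℤ} (h : M.WtLE n) (hM : M.IsBispanned) :
    (M.quot (M.top n)).WtLE (n - 1) := fun μ hμ => by
  rcases eq_or_ne μ n with rfl | hne
  · rw [Submodule.eq_bot_iff]
    intro v hv
    obtain ⟨v, rfl⟩ := mkHom_surjective (M.top μ) v
    obtain ⟨m, hm, hmv⟩ := hM.exists_wt (mkHom (M.top μ)).toLieHom hv
    rw [← hmv]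
    exact mkHom_eq_zero.mpr (wt_le_top hm)
  · exact h.of_surjective hM _ (mkHom_surjective _) μ (by lia)

end GrMod

/-! ### Extensions of layered modules -/

lemma isRetract_weylSum_sum {n : ℕ} {J K : Type*} {p : J → ℤ} {q : K → ℤ} {V : GrMod}
    (α : Hom V (weylSum n p)) (β : Hom V (weylSum n q)) (φ : Hom (weylSum n p) V)
    (ψ : Hom (weylSum n q) V)
    (h : ∀ v, φ.toLieHom (α.toLieHom v) + ψ.toLieHom (β.toLieHom v) = v) :
    IsRetract V (weylSum n (Sum.elim p q)) := by
  let ι₁ : Hom (weylSum n p) (weylSum n (Sum.elim p q)) :=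
    descHom fun j => ofHom (fun j => weyl n (Sum.elim p q j)) (Sum.inl j)
  let ι₂ : Hom (weylSum n q) (weylSum n (Sum.elim p q)) :=
    descHom fun k => ofHom (fun j => weyl n (Sum.elim p q j)) (Sum.inr k)
  let F : ∀ j : J ⊕ K, Hom (weyl n (Sum.elim p q j)) V := fun j => match j with
    | Sum.inl j => (ofHom (fun j => weyl n (p j)) j).then φ
    | Sum.inr k => (ofHom (fun k => weyl n (q k)) k).then ψ
  let π : Hom (weylSum n (Sum.elim p q)) V := descHom F
  have h₁ : ∀ v, π.toLieHom (ι₁.toLieHom v) = φ.toLieHom v := fun v => by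
    refine directSum_hom_ext (f := (ι₁.then π).toLieHom) (g := φ.toLieHom) (fun j v => ?_) v
    exact (congrArg π.toLieHom (descHom_ofHom
      (fun j => ofHom (fun j => weyl n (Sum.elim p q j)) (Sum.inl j)) j v)).trans
      (descHom_ofHom F (Sum.inl j) v)
  have h₂ : ∀ v, π.toLieHom (ι₂.toLieHom v) = ψ.toLieHom v := fun v => by
    refine directSum_hom_ext (f := (ι₂.then π).toLieHom) (g := ψ.toLieHom) (fun j v => ?_) v
    exact (congrArg π.toLieHom (descHom_ofHom
      (fun j => ofHom (fun j => weyl n (Sum.elim p q j)) (Sum.inr j)) j v)).trans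
      (descHom_ofHom F (Sum.inr j) v)
  refine ⟨(α.then ι₁).add (β.then ι₂), π, fun v => ?_⟩
  rw [Hom.add_apply, map_add, Hom.then_apply, Hom.then_apply, h₁, h₂, h]

/-- Extensions of layered modules are layered. -/
theorem layered_of_exact (n : ℕ) {A B C : GrMod} (hA : A.IsBdd) (hB : B.IsBdd) (hC : C.IsBdd)
    (f : Hom A B) (g : Hom B C) (hf : Function.Injective f.toLieHom)
    (hg : Function.Surjective g.toLieHom)
    (hfg : ∀ b, g.toLieHom b = 0 ↔ ∃ a, f.toLieHom a = b) (hw : B.WtLE (n - 1))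
    (hLA : Layered n A) (hLC : Layered n C) : Layered n B := by
  induction n generalizing A B C with
  | zero =>
    have hLA : Subsingleton A := hLA
    have hLC : Subsingleton C := hLC
    refine ⟨fun v w => ?_⟩
    obtain ⟨a, rfl⟩ := (hfg v).mp (Subsingleton.elim _ _)
    obtain ⟨b, rfl⟩ := (hfg w).mp (Subsingleton.elim _ _)
    rw [Subsingleton.elim a b]
  | succ n ih =>
    rw [Nat.cast_succ, add_sub_cancel_right] at hw
    have hgf : ∀ a, g.toLieHom (f.toLieHom a) = 0 := fun a => (hfg _).mpr ⟨a, rfl⟩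
    obtain ⟨mA, uA, uA', hA', -⟩ := hLA.1.exists_inverse
    obtain ⟨mC, uC, uC', hC', hC''⟩ := hLC.1.exists_inverse
    -- Generators of the highest layer of `C` are lifted to bihomogeneous vectors of `B`; they
    -- define a map `φ` that splits the sequence over `C.top n`.
    choose b hb hgb using fun q : (p : ℤ) × Fin (mC p) =>
      hB.isBispanned.exists_bideg hC.iSupIndep_bideg g (q := (q.1, (n : ℤ)))
        (v := (hg (uC'.toLieHom (sumGen n (fun q : (p : ℤ) × Fin (mC p) => q.1) q)).1).choose) (by
          rw [(hg _).choose_spec]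
          exact map_mem_bideg (uC'.then (inclHom (C.top n))) (sumGen_mem_bideg q))
    obtain ⟨φ, hφ⟩ := (hB.isHighest hw).exists_sum_hom b hb
    have hgφ : ∀ x, g.toLieHom (φ.toLieHom x) = (uC'.toLieHom x).1 := fun x =>
      weylSum_hom_ext (f := (φ.then g).toLieHom) (g := (uC'.then (inclHom (C.top n))).toLieHom)
        (fun q => by
          rw [Hom.then_apply, hφ, hgb]
          exact (hg _).choose_spec) x
    have hφtop : ∀ x, φ.toLieHom x ∈ B.top n := fun x => by
      have : (B.top n).comap φ.toLieHom = ⊤ :=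
        weylSum_eq_top fun q => wt_le_top (map_mem_wt φ.toLieHom (sumGen_mem_bideg q).2)
      exact (this ▸ LieSubmodule.mem_top x : x ∈ (B.top n).comap φ.toLieHom)
    -- For `v` of weight `n`, subtracting the `φ`-lift of `g v` leaves a vector of weight `n` coming
    -- from `A`.
    have hdec : ∀ v ∈ B.top n, ∃ a ∈ A.top n, ∃ z, f.toLieHom a + φ.toLieHom z = v := by
      have : B.top n ≤ (A.top n).map f.toLieHom ⊔ φ.toLieHom.range := by
        refine LieSubmodule.lieSpan_le.mpr fun v hv => ?_
        let y : C.sub (C.top n) := ⟨g.toLieHom v, wt_le_top (map_mem_wt g.toLieHom hv)⟩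
        have hy : y ∈ (C.sub (C.top n)).wt n := Subtype.ext (map_mem_wt g.toLieHom hv)
        obtain ⟨a, ha⟩ := (hfg (v - φ.toLieHom (uC.toLieHom y))).mp (by
          rw [map_sub, hgφ, hC']
          exact sub_self _)
        have haw : a ∈ A.wt n := hf (by
          rw [LieModuleHom.map_lie, map_smul, ha]
          exact sub_mem hv (map_mem_wt φ.toLieHom (map_mem_wt uC.toLieHom hy)))
        rw [sub_eq_iff_eq_add.mp ha.symm]
        exact add_mem (LieSubmodule.mem_sup_left ⟨a, wt_le_top haw, rfl⟩)
          (LieSubmodule.mem_sup_right ⟨_, rfl⟩)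
      intro v hv
      obtain ⟨_, ⟨a, ha, rfl⟩, _, ⟨z, rfl⟩, h⟩ := (LieSubmodule.mem_sup _ _ _).mp (this hv)
      exact ⟨a, ha, z, h⟩
    let gC : Hom (B.sub (B.top n)) (C.sub (C.top n)) :=
      ((inclHom _).then g).toSub _ fun v => map_mem_top g.toLieHom v.2
    constructor
    -- `η` extracts the component in `A.top n`, namely `v - φ (uC (g v))`, so `B.top n` is a retract
    -- of the sum of the two outer layers.
    · obtain ⟨η, hη⟩ := ((inclHom_isEmbedding (A.top n)).then
        (f.isEmbedding_of_bispanned hA.isBispanned hB.toIsGraded hf)).exists_lift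
        ((inclHom (B.top n)).sub ((gC.then uC).then φ)) fun v => by
          obtain ⟨a, ha, z, haz⟩ := hdec v.1 v.2
          refine ⟨⟨a, ha⟩, ?_⟩
          have h1 : gC.toLieHom v = uC'.toLieHom z := Subtype.ext (by
            rw [← hgφ]
            change g.toLieHom v.1 = _
            rw [← haz, map_add, hgf, zero_add])
          have h2 : ((gC.then uC).then φ).toLieHom v = φ.toLieHom z := by
            rw [Hom.then_apply, Hom.then_apply, h1, hC'']
          rw [Hom.sub_apply, h2]
          exact eq_sub_of_add_eq haz
      refine isFree_of_isRetract (hB.sub (hB.top n)) (isRetract_weylSum_sum (η.then uA)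
        (gC.then uC) (((uA'.then (inclHom _)).then f).toSub (B.top n)
          fun x => map_mem_top f.toLieHom (uA'.toLieHom x).2) (φ.toSub (B.top n) hφtop)
        fun v => Subtype.ext ?_)
      change f.toLieHom (uA'.toLieHom (uA.toLieHom (η.toLieHom v))).1 +
        φ.toLieHom (uC.toLieHom (gC.toLieHom v)) = v.1
      rw [hA']
      exact (congrArg (· + _) (hη v)).trans (sub_add_cancel _ _)
    · refine ih (hA.quot (hA.top n)) (hB.quot (hB.top n)) (hC.quot (hC.top n))
        ((f.then (mkHom _)).ofQuot (A.top n) fun v hv => by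
          rw [Hom.then_apply, mkHom_eq_zero]
          exact map_mem_top f.toLieHom hv)
        ((g.then (mkHom _)).ofQuot (B.top n) fun v hv => by
          rw [Hom.then_apply, mkHom_eq_zero]
          exact map_mem_top g.toLieHom hv) ?_ ?_ ?_
        (hw.quot_top hB.isBispanned) hLA.2 hLC.2
      -- Injectivity means that `f a ∈ B.top n` forces `a ∈ A.top n`: write `f a = f a' + φ z`;
      -- applying `g` gives `z = 0`, so `a = a'`.
      · rw [injective_iff_map_eq_zero]
        intro a ha
        obtain ⟨a, rfl⟩ := mkHom_surjective _ a
        rw [Hom.ofQuot_mk, Hom.then_apply, mkHom_eq_zero] at ha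
        obtain ⟨a', ha', z, haz⟩ := hdec _ ha
        have hz : uC'.toLieHom z = 0 := Subtype.ext (by
          rw [← hgφ, ← zero_add (g.toLieHom _), ← hgf a', ← map_add, haz, hgf]
          rfl)
        have hz : z = 0 := by rw [← hC'' z, hz, map_zero]
        rw [hz, map_zero, add_zero] at haz
        rw [← hf haz]
        exact mkHom_eq_zero.mpr ha'
      · intro c
        obtain ⟨c, rfl⟩ := mkHom_surjective _ c
        obtain ⟨b, rfl⟩ := hg c
        exact ⟨(mkHom _).toLieHom b, rfl⟩
      · intro b
        obtain ⟨b, rfl⟩ := mkHom_surjective _ b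
        rw [Hom.ofQuot_mk, Hom.then_apply, mkHom_eq_zero]
        constructor
        · intro hb
          let y : C.sub (C.top n) := ⟨g.toLieHom b, hb⟩
          obtain ⟨a, ha⟩ := (hfg (b - φ.toLieHom (uC.toLieHom y))).mp (by
            rw [map_sub, hgφ, hC']
            exact sub_self _)
          refine ⟨(mkHom _).toLieHom a, ?_⟩
          rw [Hom.ofQuot_mk, Hom.then_apply, ha, map_sub, mkHom_eq_zero.mpr (hφtop _), sub_zero]
        · rintro ⟨a, ha⟩
          obtain ⟨a, rfl⟩ := mkHom_surjective _ a
          rw [Hom.ofQuot_mk, Hom.then_apply, ← sub_eq_zero, ← map_sub, mkHom_eq_zero] at ha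
          have := map_mem_top g.toLieHom ha
          rw [map_sub, hgf, zero_sub] at this
          exact neg_mem_iff.mp this

end CurrentSl2

end

noncomputable section

namespace CurrentSl2

open GrMod

/-! ### Layered modules and filtrations by global Weyl modules -/

/-- Generators of weight `l` exceed the weight bound, so they map to zero in `M`. -/
lemma IsFree.subsingleton {l : ℕ} {M : GrMod} (h : IsFree l M) {n : ℤ} (hw : M.WtLE n)
    (hn : n < l) : Subsingleton M := by
  obtain ⟨m, u, u', hu, -⟩ := h.exists_inverse
  have h0 : ∀ x, u'.toLieHom x = 0 := fun x =>
    weylSum_hom_ext (g := 0) (fun q => by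
      have := map_mem_wt u'.toLieHom (sumGen_mem_bideg q).2
      rwa [hw _ hn, Submodule.mem_bot] at this) x
  exact ⟨fun v w => by rw [← hu v, ← hu w, h0, h0]⟩

lemma layered_of_isFree (n : ℕ) {l : ℕ} {M : GrMod} (hM : M.IsBdd) (h : IsFree l M)
    (hw : M.WtLE (n - 1)) : Layered n M := by
  induction n generalizing M with
  | zero => exact h.subsingleton hw (by lia)
  | succ n ih =>
    rw [Nat.cast_succ, add_sub_cancel_right] at hw
    obtain ⟨m, u, u', hu, hu'⟩ := h.exists_inverse
    -- For `n < l` the module is zero; for `n = l` it equals its highest layer; for `n > l` that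
    -- layer is zero and the quotient is a copy of `M`.
    rcases lt_trichotomy n l with hn | rfl | hn
    · exact layered_of_subsingleton _ (h.subsingleton hw (by exact_mod_cast hn))
    · have htop : M.top n = ⊤ := top_eq_top_of_surjective u' fun v => ⟨_, hu v⟩
      refine ⟨isFree_of_isRetract (hM.sub (hM.top n)) ⟨(inclHom _).then u,
        u'.toSub _ fun v => htop ▸ LieSubmodule.mem_top _, fun v => Subtype.ext (hu v.1)⟩,
        layered_of_subsingleton _ ⟨fun v w => ?_⟩⟩
      obtain ⟨v, rfl⟩ := mkHom_surjective _ v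
      obtain ⟨w, rfl⟩ := mkHom_surjective _ w
      rw [mkHom_eq_zero.mpr (htop ▸ LieSubmodule.mem_top v),
        mkHom_eq_zero.mpr (htop ▸ LieSubmodule.mem_top w)]
    · have hwt : M.WtLE l := weylSum_isHighest.wtLE.of_injective u
        (Function.LeftInverse.injective hu)
      have htop : M.top n = ⊥ := by
        rw [GrMod.top, hwt n (by exact_mod_cast hn)]
        exact eq_bot_iff.mpr (LieSubmodule.lieSpan_le.mpr fun v hv => hv)
      refine ⟨isFree_of_subsingleton ⟨fun v w => Subtype.ext ?_⟩,
        ih (hM.quot (hM.top n)) (isFree_of_isRetract (hM.quot (hM.top n)) ⟨u.ofQuot _ fun v hv => ?_,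
          u'.then (mkHom _), fun v => ?_⟩) (hw.quot_top hM.isBispanned)⟩
      · have key : ∀ v ∈ M.top n, v = 0 := fun v hv => by
          rwa [htop, LieSubmodule.mem_bot] at hv
        exact (key _ v.2).trans (key _ w.2).symm
      · rw [htop, LieSubmodule.mem_bot] at hv
        rw [hv, map_zero]
      · obtain ⟨v, rfl⟩ := mkHom_surjective _ v
        rw [Hom.ofQuot_mk, Hom.then_apply, hu]

lemma isFree_of_bijective {n : ℕ} {N P : GrMod} (hN : N.IsBdd) (hP : P.IsGraded) (j : Hom N P)
    (hj : Function.Bijective j.toLieHom) (h : IsFree n P) : IsFree n N := by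
  obtain ⟨m, u, u', hu, -⟩ := h.exists_inverse
  exact isFree_of_isRetract hN (((j.isEmbedding_of_bispanned hN.isBispanned hP hj.1).isRetract
    hj.2).2.trans ⟨u, u', hu⟩)

lemma isRetract_directSum_unit (N : GrMod) : IsRetract N (GrMod.directSum fun _ : Unit => N) :=
  ⟨ofHom (fun _ : Unit => N) (), projHom (fun _ : Unit => N) (),
    projHom_ofHom_same (N := fun _ : Unit => N) ()⟩

lemma layered_of_isRetract_single {n : ℕ} {N D : GrMod} (hD : D.IsBdd) (h : IsRetract D N)
    (hN : Layered n N) : Layered n D :=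
  layered_of_isRetract n hD (h.trans (isRetract_directSum_unit N)) fun _ => hN

/-! ### Graded preimages, subquotients and a bound on the weights -/

namespace GrMod

variable {M : GrMod}

lemma IsGradedSubmodule.comap_incl {A B : LieSubmodule ℂ Cur M} (hBA : B ≤ A)
    (hB : M.IsGradedSubmodule B) : (M.sub A).IsGradedSubmodule (B.comap A.incl) := by
  have key : ∀ b ∈ ⨆ p : ℤ, B.toSubmodule ⊓ M.deg p, ∃ w : A, w.1 = b ∧
      w ∈ ⨆ p : ℤ, (B.comap A.incl).toSubmodule ⊓ (M.sub A).deg p := fun b hb => by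
    induction hb using Submodule.iSup_induction' with
    | zero => exact ⟨0, rfl, zero_mem _⟩
    | add u v _ _ hu hv =>
      obtain ⟨u, rfl, hu⟩ := hu
      obtain ⟨v, rfl, hv⟩ := hv
      exact ⟨u + v, rfl, add_mem hu hv⟩
    | mem p v hv => exact ⟨⟨v, hBA hv.1⟩, rfl, Submodule.mem_iSup_of_mem p hv⟩
  intro v hv
  obtain ⟨w, hwv, hw⟩ := key v.1 (hB hv)
  rwa [← show w = v from Subtype.ext hwv]

lemma IsGradedSubmodule.comap_mk {T : LieSubmodule ℂ Cur M} (hT : M.IsGradedSubmodule T)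
    {A : LieSubmodule ℂ Cur (M.quot T)} (hA : (M.quot T).IsGradedSubmodule A) :
    M.IsGradedSubmodule (A.comap (mkHom T).toLieHom) := by
  have key : ∀ a ∈ ⨆ p : ℤ, A.toSubmodule ⊓ (M.quot T).deg p, ∃ w, (mkHom T).toLieHom w = a ∧
      w ∈ ⨆ p : ℤ, (A.comap (mkHom T).toLieHom).toSubmodule ⊓ M.deg p := fun a ha => by
    induction ha using Submodule.iSup_induction' with
    | zero => exact ⟨0, map_zero _, zero_mem _⟩
    | add u v _ _ hu hv =>
      obtain ⟨u, rfl, hu⟩ := hu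
      obtain ⟨v, rfl, hv⟩ := hv
      exact ⟨u + v, map_add _ _ _, add_mem hu hv⟩
    | mem p v hv =>
      obtain ⟨hv, w, hw, rfl⟩ := hv
      exact ⟨w, rfl, Submodule.mem_iSup_of_mem p ⟨hv, hw⟩⟩
  intro v hv
  obtain ⟨w, hwv, hw⟩ := key _ (hA hv)
  have hd : v - w ∈ T := by
    rw [← mkHom_eq_zero, map_sub]
    exact sub_eq_zero.mpr hwv.symm
  have hle : ⨆ p : ℤ, T.toSubmodule ⊓ M.deg p ≤
      ⨆ p : ℤ, (A.comap (mkHom T).toLieHom).toSubmodule ⊓ M.deg p :=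
    iSup_mono fun p => inf_le_inf_right _ fun x hx => by
      change (mkHom T).toLieHom x ∈ A
      rw [mkHom_eq_zero.mpr hx]
      exact zero_mem _
  rw [← sub_add_cancel v w]
  exact add_mem (hle (hT hd)) hw

/-- By definition the subquotient is the quotient of `M.sub A` by `B.comap A.incl`. -/
lemma IsBdd.subquotient (hM : M.IsBdd) {A B : LieSubmodule ℂ Cur M} (hBA : B ≤ A)
    (hA : M.IsGradedSubmodule A) (hB : M.IsGradedSubmodule B) : (M.subquotient A B).IsBdd :=
  (hM.sub hA).quot (hB.comap_incl hBA)

/-- The shift matches `Layered n`, whose first layer is generated in weight `n - 1`. -/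
lemma IsBdd.exists_wtLE (hM : M.IsBdd) : ∃ n : ℕ, M.WtLE (n - 1) := by
  obtain ⟨b, hb⟩ := hM.finite_wt.bddAbove
  refine ⟨(b + 1).toNat, fun μ hμ => ?_⟩
  by_contra h
  have := hb h
  lia

end GrMod

/-- Climb from the zero end of the filtration: each `F s` is an extension of a direct sum of global
Weyl modules by `F (s + 1)`, and `layered_of_exact` applies. -/
theorem layered_of_hasWeylFiltration {n : ℕ} {M : GrMod} (hM : M.IsBdd) (hw : M.WtLE (n - 1))
    (h : HasWeylFiltration M) : Layered n M := by
  obtain ⟨k, F, h0, hk, hF, hgr, hfree⟩ := h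
  have key : ∀ j s, s + j = k + 1 → Layered n (M.sub (F s)) := by
    intro j
    induction j with
    | zero =>
      rintro s rfl
      refine layered_of_subsingleton _ ⟨fun v w => Subtype.ext ?_⟩
      have key : ∀ v ∈ F (k + 1), v = 0 := fun v hv => by
        rwa [hk, LieSubmodule.mem_bot] at hv
      exact (key _ v.2).trans (key _ w.2).symm
    | succ j ih =>
      intro s hs
      have hsk : s ≤ k := by lia
      have hB := hM.sub (hgr s (by lia))
      have hC := hM.subquotient (hF s hsk) (hgr s (by lia)) (hgr (s + 1) (by lia))
      have hwB : (M.sub (F s)).WtLE (n - 1) := hw.of_injective _ (inclHom_injective _)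
      obtain ⟨l, hl⟩ := hfree s hsk
      refine layered_of_exact n (hM.sub (hgr (s + 1) (by lia))) hB hC
        ((inclHom (F (s + 1))).toSub (F s) fun v => hF s hsk v.2)
        (mkHom (M := M.sub (F s)) ((F (s + 1)).comap (F s).incl))
        (fun v w h => Subtype.ext (congrArg (fun x : F s => x.1) h)) (mkHom_surjective _)
        (fun b => ?_) hwB (ih (s + 1) (by lia)) (layered_of_isFree n hC hl
          (hwB.of_surjective hB.isBispanned _ (mkHom_surjective (M := M.sub (F s)) _)))
      refine mkHom_eq_zero.trans ⟨fun hb => ⟨⟨b.1, hb⟩, rfl⟩, ?_⟩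
      rintro ⟨a, rfl⟩
      exact a.2
  refine layered_of_isRetract_single hM ⟨(Hom.idHom M).toSub (F 0) fun v => ?_, inclHom (F 0),
    fun v => rfl⟩ (key (k + 1) 0 (zero_add _))
  rw [h0]
  exact LieSubmodule.mem_top _

theorem hasWeylFiltration_of_layered (n : ℕ) {M : GrMod} (hM : M.IsBdd) (h : Layered n M) :
    HasWeylFiltration M := by
  induction n generalizing M with
  | zero =>
    have h : Subsingleton M := h
    have hbot : M.IsGradedSubmodule ⊥ := fun v hv => by
      rw [Subsingleton.elim v 0]
      exact zero_mem _
    refine ⟨0, fun _ => ⊥, ?_, rfl, fun _ _ => le_rfl, fun _ _ => hbot, fun s _ => ⟨0, ?_⟩⟩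
    · ext v
      rw [Subsingleton.elim v 0]
      exact ⟨fun _ => trivial, fun _ => zero_mem _⟩
    · exact isFree_of_subsingleton (subsingleton_quot (M := M.sub ⊥)
        ⟨fun _ _ => Subtype.ext (Subsingleton.elim _ _)⟩ _)
  | succ n ih =>
    have hT := hM.top n
    obtain ⟨k, F, h0, hk, hF, hgr, hfree⟩ := ih (hM.quot hT) h.2
    -- Pull back the filtration of the quotient and append zero. As `F (k + 1) = ⊥`, its preimage is
    -- `M.top n`, which becomes the last layer.
    let F' : ℕ → LieSubmodule ℂ Cur M := fun s =>
      if s ≤ k + 1 then (F s).comap (mkHom (M.top n)).toLieHom else ⊥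
    have hF' : ∀ s ≤ k + 1, F' s = (F s).comap (mkHom (M.top n)).toLieHom := fun s hs => if_pos hs
    have hbot : F' (k + 1 + 1) = ⊥ := if_neg (by lia)
    have hle : ∀ s ≤ k + 1, F' (s + 1) ≤ F' s := fun s hs => by
      rcases hs.lt_or_eq with hs' | rfl
      · rw [hF' s hs, hF' (s + 1) hs']
        exact fun v hv => hF s (by lia) hv
      · rw [hbot]
        exact bot_le
    have hgr' : ∀ s ≤ k + 1 + 1, M.IsGradedSubmodule (F' s) := fun s hs => by
      rcases hs.lt_or_eq with hs' | rfl
      · rw [hF' s (by lia)]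
        exact hT.comap_mk (hgr s (by lia))
      · rw [hbot]
        exact fun v hv => by
          rw [(LieSubmodule.mem_bot v).mp hv]
          exact zero_mem _
    refine ⟨k + 1, F', ?_, hbot, hle, hgr', fun s hs => ?_⟩
    · rw [hF' 0 (by lia), h0]
      rfl
    have hbdd := hM.subquotient (hle s hs) (hgr' s (by lia)) (hgr' (s + 1) (by lia))
    have hmem : ∀ v : M, v ∈ F' s ↔ (mkHom (M.top n)).toLieHom v ∈ F s := fun v => by
      rw [hF' s hs]
      rfl
    rcases hs.lt_or_eq with hs' | rfl
    · have hmem' : ∀ v : M, v ∈ F' (s + 1) ↔ (mkHom (M.top n)).toLieHom v ∈ F (s + 1) := fun v => by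
        rw [hF' (s + 1) hs']
        rfl
      have hsk : s ≤ k := by lia
      obtain ⟨l, hl⟩ := hfree s hsk
      let c : Hom (M.sub (F' s)) ((M.quot (M.top n)).sub (F s)) :=
        ((inclHom (F' s)).then (mkHom (M.top n))).toSub (F s) fun v => (hmem v.1).mp v.2
      let d : Hom (M.sub (F' s)) ((M.quot (M.top n)).subquotient (F s) (F (s + 1))) :=
        c.then (mkHom (M := (M.quot (M.top n)).sub (F s)) ((F (s + 1)).comap (F s).incl))
      have hd : ∀ v : M.sub (F' s), d.toLieHom v = 0 ↔ v.1 ∈ F' (s + 1) := fun v =>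
        mkHom_eq_zero.trans (hmem' v.1).symm
      refine ⟨l, isFree_of_bijective hbdd ((hM.quot hT).subquotient (hF s hsk)
        (hgr s (by lia)) (hgr (s + 1) (by lia))).toIsGraded
        (d.ofQuot ((F' (s + 1)).comap (F' s).incl) fun v hv => (hd v).mpr hv) ⟨?_, ?_⟩ hl⟩
      · rw [injective_iff_map_eq_zero]
        intro v hv
        obtain ⟨v, rfl⟩ := mkHom_surjective (M := M.sub (F' s)) _ v
        exact mkHom_eq_zero.mpr ((hd v).mp hv)
      · intro w
        obtain ⟨w, rfl⟩ := mkHom_surjective (M := (M.quot (M.top n)).sub (F s)) _ w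
        obtain ⟨v, hv⟩ := mkHom_surjective _ w.1
        let v' : M.sub (F' s) := ⟨v, (hmem v).mpr (hv ▸ w.2)⟩
        exact ⟨(mkHom (M := M.sub (F' s)) _).toLieHom v',
          congrArg (mkHom (M := (M.quot (M.top n)).sub (F s)) _).toLieHom (Subtype.ext hv)⟩
    · have hmem' : ∀ v : M, v ∈ F' (k + 1) ↔ v ∈ M.top n := fun v => by
        rw [hmem, hk, LieSubmodule.mem_bot]
        exact mkHom_eq_zero
      let d : Hom (M.sub (F' (k + 1))) (M.sub (M.top n)) :=
        (inclHom _).toSub (M.top n) fun v => (hmem' v.1).mp v.2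
      have hd : ∀ v : M.sub (F' (k + 1)), d.toLieHom v = 0 ↔ v.1 ∈ F' (k + 1 + 1) := fun v => by
        rw [hbot]
        exact Subtype.ext_iff.trans (LieSubmodule.mem_bot v.1).symm
      refine ⟨n, isFree_of_bijective hbdd (hM.sub hT).toIsGraded
        (d.ofQuot ((F' (k + 1 + 1)).comap (F' (k + 1)).incl) fun v hv => (hd v).mpr hv)
        ⟨?_, ?_⟩ h.1⟩
      · rw [injective_iff_map_eq_zero]
        intro v hv
        obtain ⟨v, rfl⟩ := mkHom_surjective (M := M.sub (F' (k + 1))) _ v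
        exact mkHom_eq_zero.mpr ((hd v).mp hv)
      · intro w
        let v' : M.sub (F' (k + 1)) := ⟨w.1, (hmem' w.1).mpr w.2⟩
        exact ⟨(mkHom (M := M.sub (F' (k + 1))) _).toLieHom v', rfl⟩

end CurrentSl2

end

/-! ### The three closure properties -/

theorem mainTheorem10 :
    (∀ N M : IBdd.{u}, IsDirectSummand N M → weylFiltered M → weylFiltered N) ∧
    (∀ (A B C : IBdd.{u}) (f : A ⟶ B) (g : B ⟶ C), IsShortExact f g →
      weylFiltered A → weylFiltered C → weylFiltered B) ∧
    (∀ (ι : Type v) (N : ι → IBdd.{u}) (hN : (GrMod.directSum fun i => (N i).obj).IsBdd),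
      (∀ i, weylFiltered (N i)) → weylFiltered ⟨GrMod.directSum fun i => (N i).obj, hN⟩) := by
  refine ⟨fun N M hNM hM => ?_, fun A B C f g hfg hA hC => ?_, fun ι N hN h => ?_⟩
  · obtain ⟨N', ⟨e⟩⟩ := hNM
    obtain ⟨n, hn⟩ := M.property.exists_wtLE
    have hr : IsRetract N.obj M.obj :=
      ⟨(GrMod.ofHom ![N.obj, N'.obj] 0).then e.inv, GrMod.Hom.then e.hom (GrMod.projHom _ 0),
        fun v => (congrArg (fun φ : GrMod.directSum ![N.obj, N'.obj] ⟶ _ =>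
          (GrMod.projHom _ 0).toLieHom (GrMod.Hom.fn φ ((GrMod.ofHom _ 0).toLieHom v)))
          e.inv_hom_id).trans (GrMod.projHom_ofHom_same (N := ![N.obj, N'.obj]) 0 v)⟩
    exact hasWeylFiltration_of_layered n N.property (layered_of_isRetract_single N.property hr
      (layered_of_hasWeylFiltration M.property hn hM))
  · obtain ⟨n, hn⟩ := B.property.exists_wtLE
    exact hasWeylFiltration_of_layered n B.property (layered_of_exact n A.property B.property
      C.property f.hom g.hom hfg.injective hfg.surjective hfg.exact hn
      (layered_of_hasWeylFiltration A.property (hn.of_injective f.hom hfg.injective) hA)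
      (layered_of_hasWeylFiltration C.property
        (hn.of_surjective B.property.isBispanned g.hom hfg.surjective) hC))
  -- Each `N i` embeds in the sum, so one `n` bounds all weights; the sum is then treated as a
  -- retract of itself.
  · obtain ⟨n, hn⟩ := hN.exists_wtLE
    refine hasWeylFiltration_of_layered n hN (layered_of_isRetract n hN (IsRetract.refl _) fun i =>
      layered_of_hasWeylFiltration (N i).property (hn.of_injective
        (GrMod.ofHom (fun i => (N i).obj) i) ?_) (h i))
    exact Function.LeftInverse.injective
      (GrMod.projHom_ofHom_same (N := fun i => (N i).obj) i)
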